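/- Let $1\le K\le N$, $M<N$, let $\Phi,\Delta\in\mathbb R^{M\times N}$, let $\Psi\in\mathbb R^{N\times N}$ be invertible, let $s\in\mathbb R^N$, $x=\Psi s$, $y=\Phi x\neq 0$, and $e\in\mathbb R^M$. Put $\tilde y=y+e$, $\tilde\Phi=\Phi+\Delta$, $A=\Phi\Psi$, $E=\Delta\Psi$, $\tilde A=\tilde\Phi\Psi=A+E$. For a vector $v$ let $v_K$ denote a best $K$-term approximation of $v$, that is, a vector with at most $K$ nonzero entries at minimal Euclidean distance from $v$ (ties are broken arbitrarily), and let $\operatorname{supp}(v)$ be the support of $v$. Define $$r_K=\frac{\|s-s_K\|_2}{\|s\|_2},\quad s_K^{\mathrm{rel}}=\frac{\|s-s_K\|_1}{\sqrt K\,\|s\|_2},\quad \varepsilon_y=\frac{\|e\|_2}{\|y\|_2},\quad \varepsilon_A^{(K)}=\frac{\|E\|_2^{(K)}}{\|A\|_2^{(K)}},\quad \kappa_\Psi=\|\Psi\|_2\|\Psi^{-1}\|_2,$$ where $\|\cdot\|_2$ of a matrix is the spectral norm and $\|B\|_2^{(K)}$ is the largest spectral norm of a $K$-column submatrix of $B$.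 The restricted isometry constant of level $k$ of a matrix $B$ is the smallest $\delta\ge 0$ with $(1-\delta)\|v\|_2^2\le\|Bv\|_2^2\le(1+\delta)\|v\|_2^2$ for all $v$ with at most $k$ nonzero entries. Let $\delta_K$ be that of $A$ of level $K$, and $\tilde\delta_k$ that of $\tilde A$ of level $k$. Let $s^{[0]},s^{[1]},\dots$ be the iterates of one of the following algorithms with inputs $\tilde A,\tilde y,K$, and $x^{[l]}=\Psi s^{[l]}$. Here $\mathrm{LS}(S)$ denotes the vector $b$ with $b_S=\tilde A_S^\dagger\tilde y$ (Moore–Penrose pseudo-inverse of the submatrix of the columns indexed by $S$) and $b_{S^c}=0$. * CoSaMP: $s^{[0]}=0$; with $u=\tilde A^{T}(\tilde y-\tilde As^{[l]})$ and $\tilde S=\operatorname{supp}(u_{2K})\cup\operatorname{supp}(s^{[l]})$, $s^{[l+1]}=\mathrm{LS}(\tilde S)_K$. Constants, with $\delta=\tilde\delta_{bK}$: $a=1$, $b=4$, $c=0.171$, $\tilde C=\frac{4\delta}{(1-\delta)^2}$, $\tilde D=\frac{6+2\delta}{1-6\delta+\delta^2}$. * SP: $S^0=\operatorname{supp}((\tilde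 A^T\tilde y)_K)$; $s^{[l]}=\mathrm{LS}(S^l)$; with $u=\tilde A^T(\tilde y-\tilde As^{[l]})$ and $\tilde S=\operatorname{supp}(u_K)\cup S^l$, $S^{l+1}=\operatorname{supp}(\mathrm{LS}(\tilde S)_K)$. Constants, with $\delta=\tilde\delta_{bK}$: $a=1.26$, $b=3$, $c=0.206$, $\tilde C=\frac{2\delta+2\delta^2}{(1-\delta)^3}$, $\tilde D=\frac{5-4\delta-8\delta^2-\delta^4}{1-6\delta+6\delta^2-2\delta^3+\delta^4}$. * IHT: $s^{[0]}=0$; $s^{[l+1]}=\bigl(s^{[l]}+\tilde A^T(\tilde y-\tilde As^{[l]})\bigr)_K$. Constants, with $\delta=\tilde\delta_{bK}$: $a=1$, $b=3$, $c=0.353$, $\tilde C=\sqrt8\,\delta$, $\tilde D=\frac{2\sqrt{1+\delta}}{1-\sqrt8\,\delta}$. If $\tilde\delta_{bK}\le c$, then $0<\tilde C<1$ and, for every $l\ge 0$, $$\frac{\|x-x^{[l]}\|_2}{\|x\|_2}\le\kappa_\Psi\Bigl(a\tilde C^{\,l}+r_K+\tilde D\sqrt{1+\delta_K}\,\bigl(\varepsilon_y+\varepsilon_A^{(K)}+(1+\varepsilon_y)(r_K+s_K^{\mathrm{rel}})\bigr)\Bigr).$$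 If moreover $\varepsilon_y+\varepsilon_A^{(K)}+s_K^{\mathrm{rel}}>0$, then for every $l\ge 0$ with $l\ge\bigl\lceil\log_{\tilde C}\bigl((\varepsilon_y+\varepsilon_A^{(K)}+s_K^{\mathrm{rel}})/a\bigr)\bigr\rceil$, $$\frac{\|x-x^{[l]}\|_2}{\|x\|_2}\le\kappa_\Psi\bigl(\tilde D\sqrt{1+\delta_K}+1\bigr)\bigl(\varepsilon_y+\varepsilon_A^{(K)}+(1+\varepsilon_y)(r_K+s_K^{\mathrm{rel}})\bigr).$$ -/

import Mathlib

open Matrix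
open scoped Matrix.Norms.L2Operator

noncomputable section

namespace GreedyPursuits

/-! ### Norms of vectors, sparsity, best `K`-term approximation

Matrix norms below are the spectral (`ℓ₂ → ℓ₂` operator) norm. -/

/-- The Euclidean norm of a vector. -/
def l2 {ι : Type*} [Fintype ι] (v : ι → ℝ) : ℝ := ‖WithLp.toLp 2 v‖

/-- The `ℓ₁` norm of a vector. -/
def l1 {ι : Type*} [Fintype ι] (v : ι → ℝ) : ℝ := ‖WithLp.toLp 1 v‖

/-- The support of a vector. -/
def supp {N : ℕ} (v : Fin N → ℝ) : Finset (Fin N) := Finset.univ.filter fun i => v i ≠ 0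

/-- `v` is `K`-sparse: at most `K` of its entries are nonzero. -/
def IsSparse {N : ℕ} (K : ℕ) (v : Fin N → ℝ) : Prop := (supp v).card ≤ K

/-- `t` is a best `K`-term approximation `v_K` of `v`: a `K`-sparse vector at minimal Euclidean
distance from `v` (ties between entries of equal magnitude may be broken in any way). -/
def IsBestApprox {N : ℕ} (K : ℕ) (v t : Fin N → ℝ) : Prop :=
  IsSparse K t ∧ ∀ w : Fin N → ℝ, IsSparse K w → l2 (v - t) ≤ l2 (v - w)

/-! ### Restricted isometry constant, column submatrices -/

/-- The restricted isometry constant `δ_K` of `A`: the smallest `δ ≥ 0` such that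
`(1 - δ) ‖v‖² ≤ ‖A v‖² ≤ (1 + δ) ‖v‖²` for every `K`-sparse `v`. -/
def ric {M N : ℕ} (A : Matrix (Fin M) (Fin N) ℝ) (K : ℕ) : ℝ :=
  sInf {δ : ℝ | 0 ≤ δ ∧ ∀ v : Fin N → ℝ, IsSparse K v →
    (1 - δ) * l2 v ^ 2 ≤ l2 (A *ᵥ v) ^ 2 ∧ l2 (A *ᵥ v) ^ 2 ≤ (1 + δ) * l2 v ^ 2}

/-- The submatrix `A_S` of the columns of `A` indexed by `S`. -/
def colSub {M N : ℕ} (A : Matrix (Fin M) (Fin N) ℝ) (S : Finset (Fin N)) : Matrix (Fin M) S ℝ :=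
  A.submatrix id (fun i : S => (i : Fin N))

/-- `‖A‖₂^{(K)}`: the largest spectral norm of a `K`-column submatrix of `A`. -/
def colNorm {M N : ℕ} (A : Matrix (Fin M) (Fin N) ℝ) (K : ℕ) : ℝ :=
  sSup {r : ℝ | ∃ S : Finset (Fin N), S.card = K ∧ r = ‖colSub A S‖}

/-! ### The Moore–Penrose pseudo-inverse -/

/-- The four Penrose equations: `P` is the pseudo-inverse of the real matrix `A`. -/
def IsPinv {m n : Type*} [Fintype m] [Fintype n] (A : Matrix m n ℝ) (P : Matrix n m ℝ) : Prop :=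
  A * P * A = A ∧ P * A * P = P ∧ (A * P)ᵀ = A * P ∧ (P * A)ᵀ = P * A

theorem exists_isPinv {m n : Type*} [Fintype m] [Fintype n] [DecidableEq n]
    (A : Matrix m n ℝ) : ∃ P, IsPinv A P := by
  have hH : (Aᵀ * A).IsHermitian := by
    have := isHermitian_conjTranspose_mul_self A
    rwa [conjTranspose_eq_transpose_of_trivial] at this
  obtain ⟨U, V, d, hVU, hUV, hVt, hspec⟩ : ∃ (U V : Matrix n n ℝ) (d : n → ℝ),
      V * U = 1 ∧ U * V = 1 ∧ Uᵀ = V ∧ Aᵀ * A = U * diagonal d * V := by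
    refine ⟨hH.eigenvectorUnitary, star (hH.eigenvectorUnitary : Matrix n n ℝ), hH.eigenvalues,
      Unitary.coe_star_mul_self _, Unitary.coe_mul_star_self _, ?_, ?_⟩
    · rw [star_eq_conjTranspose, conjTranspose_eq_transpose_of_trivial]
    · have := hH.spectral_theorem
      rw [Unitary.conjStarAlgAut_apply] at this
      exact this
  have hUt : Vᵀ = U := by rw [← hVt, transpose_transpose]
  set H := Aᵀ * A with hHdef
  set G := U * diagonal (fun i => (d i)⁻¹) * V with hG
  have key : ∀ a b : n → ℝ, U * diagonal a * V * (U * diagonal b * V)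
      = U * diagonal (fun i => a i * b i) * V := by
    intro a b
    calc _ = U * diagonal a * (V * U) * diagonal b * V := by simp only [Matrix.mul_assoc]
      _ = _ := by rw [hVU, Matrix.mul_one, Matrix.mul_assoc U, diagonal_mul_diagonal]
  have hsymm : ∀ a : n → ℝ, (U * diagonal a * V)ᵀ = U * diagonal a * V := by
    intro a
    rw [transpose_mul, transpose_mul, diagonal_transpose, hUt, hVt, Matrix.mul_assoc]
  have hGt : Gᵀ = G := hsymm _
  have hHt : Hᵀ = H := by rw [hspec]; exact hsymm _
  have hGHt : (G * H)ᵀ = G * H := by rw [hspec, hG, key]; exact hsymm _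
  have hHGH : H * G * H = H := by
    rw [hspec, hG, key, key]
    congr 3
    funext i
    by_cases h : d i = 0 <;> simp [h]
  have hGHG : G * H * G = G := by
    rw [hspec, hG, key, key]
    congr 3
    funext i
    by_cases h : d i = 0 <;> simp [h]
  have hHG : (G * H)ᵀ = H * G := by rw [transpose_mul, hGt, hHt]
  have hX : A * (G * H - 1) = 0 := by
    have h0 : (A * (G * H - 1))ᴴ * (A * (G * H - 1)) = 0 := by
      rw [conjTranspose_eq_transpose_of_trivial, transpose_mul, transpose_sub, hHG, transpose_one]
      calc (H * G - 1) * Aᵀ * (A * (G * H - 1)) = (H * G * H - H) * (G * H - 1) := by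
            rw [hHdef]; simp only [Matrix.mul_assoc, Matrix.sub_mul, Matrix.one_mul]
        _ = 0 := by rw [hHGH, sub_self, Matrix.zero_mul]
    exact conjTranspose_mul_self_eq_zero.mp h0
  refine ⟨G * Aᵀ, ?_, ?_, ?_, ?_⟩
  · rw [Matrix.mul_sub, Matrix.mul_one, sub_eq_zero] at hX
    simpa only [Matrix.mul_assoc] using hX
  · calc G * Aᵀ * A * (G * Aᵀ) = G * H * G * Aᵀ := by rw [hHdef]; simp only [Matrix.mul_assoc]
      _ = G * Aᵀ := by rw [hGHG]
  · rw [transpose_mul, transpose_mul, hGt, transpose_transpose, Matrix.mul_assoc]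
  · rw [Matrix.mul_assoc]; exact hGHt

/-- The Moore–Penrose pseudo-inverse `A†`. -/
def pinv {m n : Type*} [Fintype m] [Fintype n] [DecidableEq n] (A : Matrix m n ℝ) : Matrix n m ℝ :=
  (exists_isPinv A).choose

/-- The vector `b` with `b_S = A_S† y` and `b_{Sᶜ} = 0`. -/
def lsOn {M N : ℕ} (A : Matrix (Fin M) (Fin N) ℝ) (S : Finset (Fin N)) (y : Fin M → ℝ) :
    Fin N → ℝ :=
  fun i => if h : i ∈ S then (pinv (colSub A S) *ᵥ y) ⟨i, h⟩ else 0

/-! ### The three algorithms -/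

/-- The greedy pursuits with replacement. -/
inductive Pursuit
  | CoSaMP
  | SP
  | IHT

/-- `s 0, s 1, s 2, …` are the iterates of CoSaMP with inputs `A`, `y`, `K`
(for some way of breaking ties). -/
def IsCoSaMPRun {M N : ℕ} (A : Matrix (Fin M) (Fin N) ℝ) (y : Fin M → ℝ) (K : ℕ)
    (s : ℕ → Fin N → ℝ) : Prop :=
  s 0 = 0 ∧ ∀ l : ℕ, ∃ u₂ : Fin N → ℝ,
    IsBestApprox (2 * K) (Aᵀ *ᵥ (y - A *ᵥ s l)) u₂ ∧
    IsBestApprox K (lsOn A (supp u₂ ∪ supp (s l)) y) (s (l + 1))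

/-- `s 0, s 1, s 2, …` are the iterates of SP with inputs `A`, `y`, `K`
(for some way of breaking ties); `S l` is the support estimate of step `l`. -/
def IsSPRun {M N : ℕ} (A : Matrix (Fin M) (Fin N) ℝ) (y : Fin M → ℝ) (K : ℕ)
    (s : ℕ → Fin N → ℝ) : Prop :=
  ∃ S : ℕ → Finset (Fin N),
    (∃ u₁ : Fin N → ℝ, IsBestApprox K (Aᵀ *ᵥ y) u₁ ∧ S 0 = supp u₁) ∧
    (∀ l : ℕ, s l = lsOn A (S l) y) ∧
    ∀ l : ℕ, ∃ u₁ p₁ : Fin N → ℝ,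
      IsBestApprox K (Aᵀ *ᵥ (y - A *ᵥ s l)) u₁ ∧
      IsBestApprox K (lsOn A (supp u₁ ∪ S l) y) p₁ ∧
      S (l + 1) = supp p₁

/-- `s 0, s 1, s 2, …` are the iterates of IHT with inputs `A`, `y`, `K`
(for some way of breaking ties). -/
def IsIHTRun {M N : ℕ} (A : Matrix (Fin M) (Fin N) ℝ) (y : Fin M → ℝ) (K : ℕ)
    (s : ℕ → Fin N → ℝ) : Prop :=
  s 0 = 0 ∧ ∀ l : ℕ, IsBestApprox K (s l + Aᵀ *ᵥ (y - A *ᵥ s l)) (s (l + 1))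

/-- `s` is the sequence of iterates of the given algorithm. -/
def Pursuit.IsRun {M N : ℕ} (alg : Pursuit) (A : Matrix (Fin M) (Fin N) ℝ) (y : Fin M → ℝ) (K : ℕ)
    (s : ℕ → Fin N → ℝ) : Prop :=
  match alg with
  | .CoSaMP => IsCoSaMPRun A y K s
  | .SP => IsSPRun A y K s
  | .IHT => IsIHTRun A y K s

/-! ### The constants -/

/-- The constant `a`. -/
def Pursuit.a : Pursuit → ℝ
  | .CoSaMP => 1
  | .SP => 1.26
  | .IHT => 1

/-- The constant `b`. -/
def Pursuit.b : Pursuit → ℕ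
  | .CoSaMP => 4
  | .SP => 3
  | .IHT => 3

/-- The constant `c`. -/
def Pursuit.c : Pursuit → ℝ
  | .CoSaMP => 0.171
  | .SP => 0.206
  | .IHT => 0.353

/-- The constant `C`, as a function of `δ = δ_{bK}`. -/
def Pursuit.C : Pursuit → ℝ → ℝ
  | .CoSaMP, δ => 4 * δ / (1 - δ) ^ 2
  | .SP, δ => (2 * δ + 2 * δ ^ 2) / (1 - δ) ^ 3
  | .IHT, δ => √8 * δ

/-- The constant `D`, as a function of `δ = δ_{bK}`. -/
def Pursuit.D : Pursuit → ℝ → ℝ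
  | .CoSaMP, δ => (6 + 2 * δ) / (1 - 6 * δ + δ ^ 2)
  | .SP, δ => (5 - 4 * δ - 8 * δ ^ 2 - δ ^ 4) / (1 - 6 * δ + 6 * δ ^ 2 - 2 * δ ^ 3 + δ ^ 4)
  | .IHT, δ => 2 * √(1 + δ) / (1 - √8 * δ)

end GreedyPursuits

end

/-! The data can be read as noisy measurements of an exactly sparse vector: `ỹ = Ã s_K + w` with `w
= e - E s_K + A (s - s_K)`. A run on `ỹ` is thus a run on `Ã` with the `K`-sparse signal `s_K` and
noise `w`, and everything reduces to three estimates.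

Convergence for sparse signals (`Pursuit.error_le`): polarizing the restricted isometry inequality
shows that `ÃᵀÃ` acts almost as the identity on small supports (`RIP.l2_res_sub_corr_le`). Hence the
largest correlations with a residual locate most of the missing energy, and least squares or
thresholding loses only a bounded factor. Each algorithm satisfies an affine recursion with factor
at most `C < 1`, which sums to `a C^l ‖s_K‖ + D ‖w‖`.

Size of the noise (`l2_perturbation_le`): the sparse parts are controlled by `‖·‖₂^{(K)}` and `δ_K`,
the tail `A (s - s_K)` by cutting it into blocks of decreasing magnitude, which produces the `ℓ₁`
term (`l2_mulVec_le_of_sparse`).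

Change of basis: going from `s` to `x = Ψ s` costs at most `κ_Ψ` (`l2_div_mulVec_le`). Positivity of
`C` needs `δ̃ > 0`, which holds because `M < N` forbids orthonormal columns (`RIP.const_pos`). -/

namespace GreedyPursuits

/-! ### The Euclidean norm -/

section Norms

variable {ι : Type*} [Fintype ι]

theorem l2_nonneg (v : ι → ℝ) : 0 ≤ l2 v := norm_nonneg _

theorem l2_sq (v : ι → ℝ) : l2 v ^ 2 = v ⬝ᵥ v := by
  rw [l2, EuclideanSpace.norm_sq_eq]
  simp [dotProduct, sq]

theorem l2_sq_eq_sum (v : ι → ℝ) : l2 v ^ 2 = ∑ i, v i ^ 2 := by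
  rw [l2_sq]
  simp [dotProduct, sq]

theorem l1_eq_sum (v : ι → ℝ) : l1 v = ∑ i, |v i| := by
  rw [l1, PiLp.norm_eq_of_L1]
  simp

@[simp] theorem l2_zero : l2 (0 : ι → ℝ) = 0 := by simp [l2]

theorem l2_eq_zero {v : ι → ℝ} (h : l2 v = 0) : v = 0 := by
  simpa [l2] using h

theorem l2_pos {v : ι → ℝ} (h : v ≠ 0) : 0 < l2 v :=
  (l2_nonneg v).lt_of_ne fun h0 => h (l2_eq_zero h0.symm)

theorem l2_add_le (v w : ι → ℝ) : l2 (v + w) ≤ l2 v + l2 w := by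
  simpa [l2] using norm_add_le (WithLp.toLp 2 v) (WithLp.toLp 2 w)

theorem l2_smul (c : ℝ) (v : ι → ℝ) : l2 (c • v) = |c| * l2 v := by
  simp [l2, norm_smul]

theorem l2_neg (v : ι → ℝ) : l2 (-v) = l2 v := by
  simp [l2]

theorem l2_sub_le (v w : ι → ℝ) : l2 (v - w) ≤ l2 v + l2 w := by
  simpa [sub_eq_add_neg, l2_neg] using l2_add_le v (-w)

theorem l2_sub_comm (v w : ι → ℝ) : l2 (v - w) = l2 (w - v) := by
  rw [← l2_neg, neg_sub]

theorem dotProduct_le_l2 (v w : ι → ℝ) : v ⬝ᵥ w ≤ l2 v * l2 w := by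
  refine le_of_abs_le (abs_le_of_sq_le_sq ?_ (mul_nonneg (l2_nonneg v) (l2_nonneg w)))
  rw [mul_pow, l2_sq_eq_sum, l2_sq_eq_sum]
  exact Finset.sum_mul_sq_le_sq_mul_sq _ _ _

/-- Cancels one factor of the norm: a restricted vector is bounded by testing it against itself. -/
theorem l2_le_of_sq_le {v : ι → ℝ} {c : ℝ} (h : v ⬝ᵥ v ≤ l2 v * c) (hc : 0 ≤ c) : l2 v ≤ c := by
  rcases (l2_nonneg v).eq_or_lt with h0 | h0
  · rwa [← h0]
  · rw [← l2_sq, sq] at h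
    exact le_of_mul_le_mul_left h h0

theorem l2_le_of_sq_le_sq {κ : Type*} [Fintype κ] {v : ι → ℝ} {w : κ → ℝ}
    (h : l2 v ^ 2 ≤ l2 w ^ 2) : l2 v ≤ l2 w :=
  (sq_le_sq₀ (l2_nonneg _) (l2_nonneg _)).1 h

theorem l2_mono {v w : ι → ℝ} (h : ∀ i, |v i| ≤ |w i|) : l2 v ≤ l2 w := by
  apply l2_le_of_sq_le_sq
  rw [l2_sq_eq_sum, l2_sq_eq_sum]
  exact Finset.sum_le_sum fun i _ => sq_le_sq.2 (h i)

end Norms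

/-! ### Supports and restrictions -/

variable {M N : ℕ}

/-- The restriction of a vector to a set of indices, extended by zero. -/
def res (S : Finset (Fin N)) (v : Fin N → ℝ) : Fin N → ℝ := fun i => if i ∈ S then v i else 0

theorem mem_supp {v : Fin N → ℝ} {i : Fin N} : i ∈ supp v ↔ v i ≠ 0 := by simp [supp]

theorem supp_subset_iff {v : Fin N → ℝ} {S : Finset (Fin N)} :
    supp v ⊆ S ↔ ∀ i, i ∉ S → v i = 0 := by
  refine forall_congr' fun i => ?_
  rw [mem_supp]
  tauto

theorem IsSparse.of_supp_subset {k : ℕ} {v : Fin N → ℝ} {S : Finset (Fin N)} (h : supp v ⊆ S)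
    (hS : S.card ≤ k) : IsSparse k v :=
  (Finset.card_le_card h).trans hS

theorem supp_res (S : Finset (Fin N)) (v : Fin N → ℝ) : supp (res S v) ⊆ S :=
  supp_subset_iff.2 fun i hi => by simp [res, hi]

theorem supp_add (v w : Fin N → ℝ) : supp (v + w) ⊆ supp v ∪ supp w :=
  supp_subset_iff.2 fun i hi => by
    simp only [Finset.mem_union, mem_supp, not_or, not_not] at hi
    simp [hi]

theorem supp_sub (v w : Fin N → ℝ) : supp (v - w) ⊆ supp v ∪ supp w :=
  supp_subset_iff.2 fun i hi => by
    simp only [Finset.mem_union, mem_supp, not_or, not_not] at hi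
    simp [hi]

theorem supp_smul (c : ℝ) (v : Fin N → ℝ) : supp (c • v) ⊆ supp v :=
  supp_subset_iff.2 fun i hi => by
    simp only [mem_supp, not_not] at hi
    simp [hi]

theorem res_eq_self {S : Finset (Fin N)} {v : Fin N → ℝ} (h : supp v ⊆ S) : res S v = v := by
  funext i
  by_cases hi : i ∈ S
  · simp [res, hi]
  · simp [res, hi, supp_subset_iff.1 h i hi]

theorem res_add (S : Finset (Fin N)) (v w : Fin N → ℝ) : res S (v + w) = res S v + res S w := by
  funext i; by_cases hi : i ∈ S <;> simp [res, hi]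

theorem res_sub (S : Finset (Fin N)) (v w : Fin N → ℝ) : res S (v - w) = res S v - res S w := by
  funext i; by_cases hi : i ∈ S <;> simp [res, hi]

theorem res_add_res_compl (S : Finset (Fin N)) (v : Fin N → ℝ) : res S v + res Sᶜ v = v := by
  funext i; by_cases hi : i ∈ S <;> simp [res, hi]

theorem l2_res_le (S : Finset (Fin N)) (v : Fin N → ℝ) : l2 (res S v) ≤ l2 v :=
  l2_mono fun i => by by_cases hi : i ∈ S <;> simp [res, hi]

theorem l2_sq_res (S : Finset (Fin N)) (v : Fin N → ℝ) : l2 (res S v) ^ 2 = ∑ i ∈ S, v i ^ 2 := by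
  simp [l2_sq_eq_sum, res, ite_pow, Finset.sum_ite_mem]

theorem res_dotProduct_self (S : Finset (Fin N)) (v : Fin N → ℝ) :
    res S v ⬝ᵥ res S v = res S v ⬝ᵥ v := by
  refine Finset.sum_congr rfl fun i _ => ?_
  by_cases hi : i ∈ S <;> simp [res, hi]

theorem l2_sq_res_add_compl (S : Finset (Fin N)) (v : Fin N → ℝ) :
    l2 (res S v) ^ 2 + l2 (res Sᶜ v) ^ 2 = l2 v ^ 2 := by
  rw [l2_sq_res, l2_sq_res, l2_sq_eq_sum, Finset.sum_add_sum_compl]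

/-! ### Best approximations -/

section BestApprox

variable {k : ℕ} {v t : Fin N → ℝ}

theorem IsBestApprox.l2_compl_le (h : IsBestApprox k v t) {S : Finset (Fin N)} (hS : S.card ≤ k) :
    l2 (res (supp t)ᶜ v) ≤ l2 (res Sᶜ v) := by
  have h1 := h.2 (res S v) (IsSparse.of_supp_subset (supp_res S v) hS)
  have h2 : v - res S v = res Sᶜ v := by
    rw [sub_eq_iff_eq_add, add_comm, res_add_res_compl]
  rw [h2] at h1
  refine le_trans (l2_mono fun i => ?_) h1
  by_cases hi : i ∈ supp t
  · simp [res, hi]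
  · have : t i = 0 := by simpa [mem_supp] using hi
    simp [res, hi, this]

/-- `supp t` carries at least as much energy of `v` as `S` does; remove the common part `S ∩ supp t`
from both sides. -/
theorem IsBestApprox.l2_sdiff_le (h : IsBestApprox k v t) {S : Finset (Fin N)} (hS : S.card ≤ k) :
    l2 (res (S \ supp t) v) ≤ l2 (res (supp t \ S) v) := by
  apply l2_le_of_sq_le_sq
  have h1 := pow_le_pow_left₀ (l2_nonneg _) (h.l2_compl_le hS) 2
  have h2 := l2_sq_res_add_compl (supp t) v
  have h3 := l2_sq_res_add_compl S v
  have h4 : l2 (res S v) ^ 2 ≤ l2 (res (supp t) v) ^ 2 := by linarith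
  rw [l2_sq_res, l2_sq_res] at h4 ⊢
  have h5 := Finset.sum_inter_add_sum_sdiff S (supp t) fun i => v i ^ 2
  have h6 := Finset.sum_inter_add_sum_sdiff (supp t) S fun i => v i ^ 2
  rw [Finset.inter_comm] at h6
  linarith

/-- Restricting `v` to `supp t` is an admissible competitor, so minimality leaves `v - t` no energy
on `supp t`. -/
theorem IsBestApprox.eq_res (h : IsBestApprox k v t) : t = res (supp t) v := by
  have h1 := h.2 (res (supp t) v) (IsSparse.of_supp_subset (supp_res _ v) h.1)
  have h2 : v - res (supp t) v = res (supp t)ᶜ v := by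
    rw [sub_eq_iff_eq_add, add_comm, res_add_res_compl]
  rw [h2] at h1
  have h3 := l2_sq_res_add_compl (supp t) (v - t)
  have h4 : res (supp t)ᶜ (v - t) = res (supp t)ᶜ v := by
    funext i
    by_cases hi : i ∈ supp t
    · simp [res, hi]
    · have : t i = 0 := by simpa [mem_supp] using hi
      simp [res, this]
  rw [h4] at h3
  have h5 := pow_le_pow_left₀ (l2_nonneg _) h1 2
  have h6 : l2 (res (supp t) (v - t)) = 0 := by
    have : l2 (res (supp t) (v - t)) ^ 2 = 0 := le_antisymm (by linarith) (sq_nonneg _)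
    exact pow_eq_zero_iff two_ne_zero |>.1 this
  have h7 := l2_eq_zero h6
  rw [res_sub, res_eq_self (v := t) subset_rfl, sub_eq_zero] at h7
  exact h7.symm

theorem IsBestApprox.l2_le (h : IsBestApprox k v t) : l2 t ≤ l2 v := by
  conv_lhs => rw [h.eq_res]
  exact l2_res_le _ _

end BestApprox

/-! ### The restricted isometry property -/

/-- The two-sided restricted isometry inequality of level `k` with constant `δ`. -/
def RIP (A : Matrix (Fin M) (Fin N) ℝ) (k : ℕ) (δ : ℝ) : Prop :=
  ∀ v : Fin N → ℝ, IsSparse k v →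
    (1 - δ) * l2 v ^ 2 ≤ l2 (A *ᵥ v) ^ 2 ∧ l2 (A *ᵥ v) ^ 2 ≤ (1 + δ) * l2 v ^ 2

theorem l2_mulVec_le {m n : Type*} [Fintype m] [Fintype n] [DecidableEq n] (B : Matrix m n ℝ)
    (v : n → ℝ) : l2 (B *ᵥ v) ≤ ‖B‖ * l2 v :=
  Matrix.l2_opNorm_mulVec B (WithLp.toLp 2 v)

theorem ric_nonneg (A : Matrix (Fin M) (Fin N) ℝ) (k : ℕ) : 0 ≤ ric A k :=
  Real.sInf_nonneg fun _ h => h.1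

/-- The admissible constants form a nonempty closed set bounded below, so the infimum is attained.
-/
theorem rip_ric (A : Matrix (Fin M) (Fin N) ℝ) (k : ℕ) : RIP A k (ric A k) := by
  set s : Set ℝ := {δ : ℝ | 0 ≤ δ ∧ RIP A k δ} with hs
  have hne : s.Nonempty := by
    refine ⟨1 + ‖A‖ ^ 2, by positivity, fun v _ => ⟨?_, ?_⟩⟩
    · nlinarith [sq_nonneg (l2 v), sq_nonneg (‖A‖ * l2 v), sq_nonneg (l2 (A *ᵥ v))]
    · have := pow_le_pow_left₀ (l2_nonneg _) (l2_mulVec_le A v) 2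
      nlinarith [sq_nonneg (l2 v)]
  have hcl : IsClosed s := by
    have : s = Set.Ici 0 ∩ ⋂ v : Fin N → ℝ, ⋂ _ : IsSparse k v,
        {δ : ℝ | (1 - δ) * l2 v ^ 2 ≤ l2 (A *ᵥ v) ^ 2} ∩
          {δ : ℝ | l2 (A *ᵥ v) ^ 2 ≤ (1 + δ) * l2 v ^ 2} := by
      ext δ
      simp [hs, RIP]
    rw [this]
    refine isClosed_Ici.inter (isClosed_iInter fun v => isClosed_iInter fun _ => ?_)
    exact (isClosed_le (by fun_prop) (by fun_prop)).inter (isClosed_le (by fun_prop) (by fun_prop))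
  exact (hcl.csInf_mem hne ⟨0, fun _ h => h.1⟩).2

section RIP

variable {A : Matrix (Fin M) (Fin N) ℝ} {k : ℕ} {δ : ℝ}

theorem RIP.l2_mulVec_le (h : RIP A k δ) {v : Fin N → ℝ} (hv : IsSparse k v) :
    l2 (A *ᵥ v) ≤ √(1 + δ) * l2 v := by
  rw [← Real.sqrt_sq (l2_nonneg v), ← Real.sqrt_mul' _ (sq_nonneg _)]
  exact Real.le_sqrt_of_sq_le (h v hv).2

theorem RIP.le_l2_mulVec (h : RIP A k δ) {v : Fin N → ℝ} (hv : IsSparse k v) :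
    √(1 - δ) * l2 v ≤ l2 (A *ᵥ v) := by
  rw [← Real.sqrt_sq (l2_nonneg v), ← Real.sqrt_mul' _ (sq_nonneg _)]
  exact Real.sqrt_le_iff.2 ⟨l2_nonneg _, (h v hv).1⟩

/-- Polarization: scale both vectors to the common norm `‖v‖ ‖w‖`, then combine the lower bound for
their sum with the upper bound for their difference. -/
theorem RIP.dotProduct_sub_le (h : RIP A k δ) {v w : Fin N → ℝ}
    (hvw : (supp v ∪ supp w).card ≤ k) :
    v ⬝ᵥ w - A *ᵥ v ⬝ᵥ A *ᵥ w ≤ δ * (l2 v * l2 w) := by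
  rcases (l2_nonneg v).eq_or_lt with hv | hv
  · rw [l2_eq_zero hv.symm]; simp
  rcases (l2_nonneg w).eq_or_lt with hw | hw
  · rw [l2_eq_zero hw.symm]; simp
  have hv' := supp_smul (l2 w) v
  have hw' := supp_smul (l2 v) w
  set p := l2 w • v with hp
  set q := l2 v • w with hq
  have h1 := (h (p + q) (IsSparse.of_supp_subset
    ((supp_add p q).trans (Finset.union_subset_union hv' hw')) hvw)).1
  have h2 := (h (p - q) (IsSparse.of_supp_subset
    ((supp_sub p q).trans (Finset.union_subset_union hv' hw')) hvw)).2
  rw [l2_sq, l2_sq] at h1 h2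
  simp only [mulVec_add, mulVec_sub, add_dotProduct, dotProduct_add, sub_dotProduct,
    dotProduct_sub] at h1 h2
  rw [dotProduct_comm q p, dotProduct_comm (A *ᵥ q) (A *ᵥ p)] at h1 h2
  have hpp : p ⬝ᵥ p = (l2 v * l2 w) ^ 2 := by
    rw [← l2_sq, hp, l2_smul, abs_of_pos hw]; ring
  have hqq : q ⬝ᵥ q = (l2 v * l2 w) ^ 2 := by
    rw [← l2_sq, hq, l2_smul, abs_of_pos hv]
  have hpq : p ⬝ᵥ q = (l2 v * l2 w) * (v ⬝ᵥ w) := by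
    rw [hp, hq, smul_dotProduct, dotProduct_smul]; simp only [smul_eq_mul]; ring
  have hApq : A *ᵥ p ⬝ᵥ A *ᵥ q = (l2 v * l2 w) * (A *ᵥ v ⬝ᵥ A *ᵥ w) := by
    rw [hp, hq, mulVec_smul, mulVec_smul, smul_dotProduct, dotProduct_smul]
    simp only [smul_eq_mul]; ring
  rw [hpp, hqq, hpq, hApq] at h1 h2
  refine le_of_mul_le_mul_left ?_ (mul_pos hv hw)
  nlinarith

theorem dotProduct_transpose_mulVec (A : Matrix (Fin M) (Fin N) ℝ) (g : Fin N → ℝ)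
    (e : Fin M → ℝ) : g ⬝ᵥ Aᵀ *ᵥ e = A *ᵥ g ⬝ᵥ e := by
  rw [mulVec_transpose, dotProduct_comm, ← dotProduct_mulVec, dotProduct_comm]

/-- With `g` the restricted vector itself, `‖g‖² = ⟨g, r⟩ - ⟨A g, A r⟩`, and almost-orthogonality
applies. -/
theorem RIP.l2_res_sub_le (h : RIP A k δ) (hδ : 0 ≤ δ) {B : Finset (Fin N)} {r : Fin N → ℝ}
    (hB : (B ∪ supp r).card ≤ k) : l2 (res B (r - Aᵀ *ᵥ (A *ᵥ r))) ≤ δ * l2 r := by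
  refine l2_le_of_sq_le ?_ (mul_nonneg hδ (l2_nonneg r))
  rw [res_dotProduct_self]
  have hs := supp_res B (r - Aᵀ *ᵥ (A *ᵥ r))
  set g := res B (r - Aᵀ *ᵥ (A *ᵥ r))
  rw [dotProduct_sub, dotProduct_transpose_mulVec]
  have := h.dotProduct_sub_le (v := g) (w := r)
    ((Finset.card_le_card (Finset.union_subset_union hs subset_rfl)).trans hB)
  linarith

theorem RIP.l2_res_transpose_le (h : RIP A k δ) {B : Finset (Fin N)}
    (hB : B.card ≤ k) (e : Fin M → ℝ) : l2 (res B (Aᵀ *ᵥ e)) ≤ √(1 + δ) * l2 e := by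
  refine l2_le_of_sq_le ?_ (mul_nonneg (Real.sqrt_nonneg _) (l2_nonneg e))
  rw [res_dotProduct_self]
  have hs := supp_res B (Aᵀ *ᵥ e)
  set g := res B (Aᵀ *ᵥ e)
  rw [dotProduct_transpose_mulVec]
  have h1 := h.l2_mulVec_le (IsSparse.of_supp_subset hs hB)
  have h2 := dotProduct_le_l2 (A *ᵥ g) e
  nlinarith [mul_le_mul_of_nonneg_right h1 (l2_nonneg e)]

/-- The correlations with a residual `A r + e` are close to `r` on any set `B`. -/
theorem RIP.l2_res_sub_corr_le (h : RIP A k δ) (hδ : 0 ≤ δ) {B : Finset (Fin N)} {r : Fin N → ℝ}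
    (hB : (B ∪ supp r).card ≤ k) (e : Fin M → ℝ) :
    l2 (res B (r - Aᵀ *ᵥ (A *ᵥ r + e))) ≤ δ * l2 r + √(1 + δ) * l2 e := by
  have h1 := h.l2_res_sub_le hδ hB
  have h2 := h.l2_res_transpose_le
    ((Finset.card_le_card Finset.subset_union_left).trans hB) e
  rw [mulVec_add, ← sub_sub, res_sub]
  exact (l2_sub_le _ _).trans (add_le_add h1 h2)

/-- If the correlations `u` with the residual `A r + e` vanish on `R \ T`, then the support of a
best approximation of `u` catches most of the energy of `r` on `T`. -/
theorem RIP.l2_res_sdiff_le (h : RIP A k δ) (hδ : 0 ≤ δ) {k' : ℕ} {r u t : Fin N → ℝ}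
    {e : Fin M → ℝ} (hu : u = Aᵀ *ᵥ (A *ᵥ r + e)) (ht : IsBestApprox k' u t)
    {T R : Finset (Fin N)} (hT : T.card ≤ k') (hr : supp r ⊆ R)
    (hRT : ∀ i ∈ R, i ∉ T → u i = 0) (hc : (supp t ∪ R).card ≤ k) (hTR : T ⊆ R) :
    l2 (res (T \ supp t) r) ≤ 2 * δ * l2 r + 2 * √(1 + δ) * l2 e := by
  have h1 := ht.l2_sdiff_le hT
  have h2 := h.l2_res_sub_corr_le hδ (B := T \ supp t) (r := r) ((Finset.card_le_card
    (Finset.union_subset ((Finset.sdiff_subset.trans hTR).trans Finset.subset_union_right)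
      (hr.trans Finset.subset_union_right))).trans hc) e
  have h3 := h.l2_res_sub_corr_le hδ (B := supp t \ R) (r := r) ((Finset.card_le_card
    (Finset.union_subset (Finset.sdiff_subset.trans Finset.subset_union_left)
      (hr.trans Finset.subset_union_right))).trans hc) e
  rw [← hu] at h2 h3
  -- On `R \ T` the correlations vanish; outside `R` it is `r` that vanishes, so `u` is pure error
  -- there.
  have h4 : l2 (res (supp t \ T) u) ≤ l2 (res (supp t \ R) (r - u)) := by
    refine l2_mono fun i => ?_
    by_cases hi : i ∈ R
    · by_cases hiT : i ∈ T
      · simp [res, hiT]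
      · simp [res, hRT i hi hiT]
    · have : r i = 0 := supp_subset_iff.1 hr i hi
      have hiT : i ∉ T := fun h => hi (hTR h)
      simp [res, hi, hiT, this]
      split_ifs <;> simp
  have h5 : l2 (res (T \ supp t) r) ≤ l2 (res (T \ supp t) u) + l2 (res (T \ supp t) (r - u)) := by
    refine le_trans (le_of_eq ?_) (l2_add_le _ _)
    rw [← res_add, add_sub_cancel]
  linarith

end RIP

/-! ### Least squares on a set of columns -/

theorem pinv_spec {m n : Type*} [Fintype m] [Fintype n] [DecidableEq n] (A : Matrix m n ℝ) :
    IsPinv A (pinv A) := (exists_isPinv A).choose_spec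

theorem transpose_mul_mul_pinv {m n : Type*} [Fintype m] [Fintype n] [DecidableEq n]
    (A : Matrix m n ℝ) : Aᵀ * (A * pinv A) = Aᵀ := by
  obtain ⟨h1, -, h3, -⟩ := pinv_spec A
  rw [← h3, ← transpose_mul, h1]

theorem supp_lsOn (A : Matrix (Fin M) (Fin N) ℝ) (S : Finset (Fin N)) (y : Fin M → ℝ) :
    supp (lsOn A S y) ⊆ S :=
  supp_subset_iff.2 fun i hi => by simp [lsOn, hi]

theorem mulVec_eq_colSub_mulVec (A : Matrix (Fin M) (Fin N) ℝ) {S : Finset (Fin N)}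
    {v : Fin N → ℝ} (hv : supp v ⊆ S) : A *ᵥ v = colSub A S *ᵥ fun i : S => v i := by
  funext j
  simp only [mulVec, dotProduct, colSub, submatrix_apply, id]
  rw [Finset.sum_coe_sort S fun i => A j i * v i]
  refine (Finset.sum_subset (Finset.subset_univ S) fun i _ hi => ?_).symm
  rw [supp_subset_iff.1 hv i hi, mul_zero]

/-- The normal equations. They follow from the Penrose equations alone, without full column rank. -/
theorem transpose_mulVec_sub_lsOn (A : Matrix (Fin M) (Fin N) ℝ) (S : Finset (Fin N))
    (y : Fin M → ℝ) {i : Fin N} (hi : i ∈ S) : (Aᵀ *ᵥ (y - A *ᵥ lsOn A S y)) i = 0 := by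
  have h1 : A *ᵥ lsOn A S y = colSub A S *ᵥ (pinv (colSub A S) *ᵥ y) := by
    rw [mulVec_eq_colSub_mulVec A (supp_lsOn A S y)]
    congr 1
    funext i
    simp [lsOn]
  have h2 : (colSub A S)ᵀ *ᵥ (y - A *ᵥ lsOn A S y) = 0 := by
    rw [h1, mulVec_sub, mulVec_mulVec, mulVec_mulVec, Matrix.mul_assoc, transpose_mul_mul_pinv, sub_self]
  exact congrFun h2 ⟨i, hi⟩

theorem mulVec_dotProduct_sub_lsOn (A : Matrix (Fin M) (Fin N) ℝ) {S : Finset (Fin N)}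
    (y : Fin M → ℝ) {g : Fin N → ℝ} (hg : supp g ⊆ S) :
    A *ᵥ g ⬝ᵥ (y - A *ᵥ lsOn A S y) = 0 := by
  rw [← dotProduct_transpose_mulVec]
  refine Finset.sum_eq_zero fun i _ => ?_
  by_cases hi : i ∈ S
  · rw [transpose_mulVec_sub_lsOn A S y hi, mul_zero]
  · rw [supp_subset_iff.1 hg i hi, zero_mul]

section LeastSquares

variable {A : Matrix (Fin M) (Fin N) ℝ} {k : ℕ} {δ : ℝ}

/-- With `g` the error on `S` and `z` the part of `x` off `S`, the residual `A g + A z + e` is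
orthogonal to `A g`. Since `⟨g, z⟩ = 0`, this gives `‖A g‖² ≤ δ ‖g‖ ‖z‖ + ‖A g‖ ‖e‖`. -/
theorem RIP.l2_res_sub_lsOn_le (h : RIP A k δ) (hδ : 0 ≤ δ) (hδ1 : δ < 1) {S : Finset (Fin N)}
    {x : Fin N → ℝ} (hS : (S ∪ supp x).card ≤ k) (e : Fin M → ℝ) :
    l2 (res S (x - lsOn A S (A *ᵥ x + e))) ≤
      δ / (1 - δ) * l2 (res Sᶜ x) + l2 e / √(1 - δ) := by
  have hb := supp_lsOn A S (A *ᵥ x + e)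
  have hg := supp_res S (x - lsOn A S (A *ᵥ x + e))
  have hz : res Sᶜ x = res Sᶜ (x - lsOn A S (A *ᵥ x + e)) := by
    funext i
    by_cases hi : i ∈ S
    · simp [res, hi]
    · simp [res, hi, supp_subset_iff.1 hb i hi]
  have hdec := res_add_res_compl S (x - lsOn A S (A *ᵥ x + e))
  rw [← hz] at hdec
  have horth := mulVec_dotProduct_sub_lsOn A (A *ᵥ x + e) hg
  set b := lsOn A S (A *ᵥ x + e)
  set g := res S (x - b)
  have hzs : supp (res Sᶜ x) ⊆ supp x := supp_subset_iff.2 fun i hi => by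
    have : x i = 0 := by simpa [mem_supp] using hi
    simp [res, this]
  have hgz : g ⬝ᵥ res Sᶜ x = 0 := Finset.sum_eq_zero fun i _ => by
    by_cases hi : i ∈ S
    · simp [res, hi]
    · rw [supp_subset_iff.1 hg i hi, zero_mul]
  set z := res Sᶜ x
  have h1 : A *ᵥ x + e - A *ᵥ b = A *ᵥ g + A *ᵥ z + e := by
    rw [← mulVec_add, hdec, mulVec_sub]; abel
  rw [h1, dotProduct_add, dotProduct_add, ← l2_sq] at horth
  have h2 := h.dotProduct_sub_le (v := g) (w := z)
    ((Finset.card_le_card (Finset.union_subset_union hg hzs)).trans hS)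
  rw [hgz] at h2
  have h3 := dotProduct_le_l2 (A *ᵥ g) (-e)
  rw [dotProduct_neg, l2_neg] at h3
  have h4 := h.le_l2_mulVec (IsSparse.of_supp_subset hg
    ((Finset.card_le_card Finset.subset_union_left).trans hS))
  have hq : 0 < 1 - δ := by linarith
  have hsq := Real.sq_sqrt hq.le
  have hs : 0 < √(1 - δ) := Real.sqrt_pos.2 hq
  set σ := √(1 - δ)
  have hz0 := l2_nonneg z
  have hg0 := l2_nonneg g
  have he0 := l2_nonneg e
  have hA0 := l2_nonneg (A *ᵥ g)
  rw [← hsq]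
  -- If `σ ‖g‖ ≤ ‖e‖` the noise term suffices; otherwise `t (t - ‖e‖)` is increasing in the relevant
  -- range and `‖A g‖` may be lowered to `σ ‖g‖`.
  rcases le_total (σ * l2 g) (l2 e) with hc | hc
  · have : l2 g ≤ l2 e / σ := by rw [le_div_iff₀ hs]; linarith
    have : 0 ≤ δ / σ ^ 2 * l2 z := by positivity
    linarith
  · have h5 : (σ * l2 g) * (σ * l2 g - l2 e) ≤ δ * (l2 g * l2 z) := by
      have : (σ * l2 g) * (σ * l2 g - l2 e) ≤ l2 (A *ᵥ g) * (l2 (A *ᵥ g) - l2 e) :=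
        mul_le_mul h4 (by linarith) (by linarith) hA0
      nlinarith
    rcases hg0.eq_or_lt with hg1 | hg1
    · rw [← hg1]; positivity
    · have h6 : σ * (σ * l2 g - l2 e) ≤ δ * l2 z := by
        refine le_of_mul_le_mul_left ?_ hg1
        nlinarith
      have h7 : δ / σ ^ 2 * l2 z + l2 e / σ = (δ * l2 z + σ * l2 e) / σ ^ 2 := by
        field_simp
      rw [h7, le_div_iff₀ (by positivity)]
      nlinarith

theorem RIP.l2_sub_lsOn_le (h : RIP A k δ) (hδ : 0 ≤ δ) (hδ1 : δ < 1) {S : Finset (Fin N)}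
    {x : Fin N → ℝ} (hS : (S ∪ supp x).card ≤ k) (e : Fin M → ℝ) :
    l2 (x - lsOn A S (A *ᵥ x + e)) ≤ 1 / (1 - δ) * l2 (res Sᶜ x) + l2 e / √(1 - δ) := by
  have h1 := h.l2_res_sub_lsOn_le hδ hδ1 hS e
  have hb := supp_lsOn A S (A *ᵥ x + e)
  have hz : res Sᶜ x = res Sᶜ (x - lsOn A S (A *ᵥ x + e)) := by
    funext i
    by_cases hi : i ∈ S
    · simp [res, hi]
    · simp [res, hi, supp_subset_iff.1 hb i hi]
  have h2 := l2_add_le (res S (x - lsOn A S (A *ᵥ x + e)))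
    (res Sᶜ (x - lsOn A S (A *ᵥ x + e)))
  rw [res_add_res_compl, ← hz] at h2
  have h3 : 1 / (1 - δ) = 1 + δ / (1 - δ) := by
    have : 1 - δ ≠ 0 := by linarith
    field_simp; ring
  rw [h3]
  linarith

end LeastSquares

/-! ### Convergence of the pursuits on exactly sparse signals -/

/-- `h / (1 - C)` is the fixed point of the affine recursion. -/
theorem geometric_bound {z : ℕ → ℝ} {C h : ℝ} (hC0 : 0 ≤ C) (hC1 : C < 1) (hh : 0 ≤ h)
    (hz : ∀ l, z (l + 1) ≤ C * z l + h) (l : ℕ) : z l ≤ C ^ l * z 0 + h / (1 - C) := by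
  have h1 : 0 < 1 - C := by linarith
  induction l with
  | zero => have := div_nonneg hh h1.le; simpa using this
  | succ l ih =>
    have h2 := mul_le_mul_of_nonneg_left ih hC0
    have h3 : C * (h / (1 - C)) + h = h / (1 - C) := by field_simp; ring
    rw [pow_succ]
    linarith [hz l]

theorem sqrt_one_add_le {δ : ℝ} (hδ : 0 ≤ δ) : √(1 + δ) ≤ 1 + δ / 2 :=
  Real.sqrt_le_iff.2 ⟨by linarith, by nlinarith [sq_nonneg δ]⟩

theorem one_sub_le_sqrt {δ : ℝ} (hδ : 0 ≤ δ) (hδ1 : δ ≤ 1) : 1 - δ ≤ √(1 - δ) :=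
  Real.le_sqrt_of_sq_le (by nlinarith)

/-- Sharp enough for IHT, since `2.83 * 0.353 < 1`. -/
theorem sqrt_eight_lt : √8 < 2.83 := by
  rw [Real.sqrt_lt' (by norm_num)]; norm_num

theorem Pursuit.C_pos (alg : Pursuit) {δ : ℝ} (hδ : 0 < δ) (hc : δ ≤ alg.c) : 0 < alg.C δ := by
  cases alg <;> simp only [Pursuit.C, Pursuit.c] at *
  · have : 0 < 1 - δ := by norm_num at hc; linarith
    positivity
  · have : 0 < 1 - δ := by norm_num at hc; linarith
    positivity
  · positivity

theorem Pursuit.C_lt_one (alg : Pursuit) {δ : ℝ} (hδ : 0 < δ) (hc : δ ≤ alg.c) :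
    alg.C δ < 1 := by
  cases alg <;> simp only [Pursuit.C, Pursuit.c] at * <;> norm_num at hc
  · rw [div_lt_one (by have : 0 < 1 - δ := by linarith
                       positivity)]
    nlinarith
  · have : 0 < 1 - δ := by linarith
    rw [div_lt_one (by positivity)]
    have h1 : (1 - 103 / 500 : ℝ) ^ 3 ≤ (1 - δ) ^ 3 := pow_le_pow_left₀ (by norm_num) (by linarith) 3
    norm_num at h1
    nlinarith
  · nlinarith [sqrt_eight_lt]

/-! ### One step of each algorithm, then the bound for all iterates -/

section

variable {M N : ℕ} {A : Matrix (Fin M) (Fin N) ℝ} {K : ℕ} {δ : ℝ}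

/-- Off `supp s` the vectors `x` and `x - s` agree, so the energy of `x` missed by the merged
support is energy of `x - s` missed by the `2K` selected correlations. Least squares costs `1 / (1 -
δ)`; pruning costs a factor 2, because `s'` is at least as close to the least-squares vector as `x`.
-/
theorem RIP.cosamp_step (h : RIP A (4 * K) δ) (hδ : 0 ≤ δ) (hδ1 : δ < 1) {x s u₂ s' : Fin N → ℝ}
    (hx : IsSparse K x) (hs : IsSparse K s) (e : Fin M → ℝ)
    (hu : IsBestApprox (2 * K) (Aᵀ *ᵥ (A *ᵥ x + e - A *ᵥ s)) u₂)
    (hs' : IsBestApprox K (lsOn A (supp u₂ ∪ supp s) (A *ᵥ x + e)) s') :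
    l2 (x - s') ≤ 4 * δ / (1 - δ) * l2 (x - s)
      + (4 * √(1 + δ) / (1 - δ) + 2 / √(1 - δ)) * l2 e := by
  unfold IsSparse at hx hs
  have hu2 : (supp u₂).card ≤ 2 * K := hu.1
  have hr : A *ᵥ x + e - A *ᵥ s = A *ᵥ (x - s) + e := by rw [mulVec_sub]; abel
  rw [hr] at hu
  have hc1 := Finset.card_union_le (supp x) (supp s)
  have hc2 := Finset.card_union_le (supp u₂) (supp x ∪ supp s)
  have hc3 := Finset.card_union_le (supp u₂ ∪ supp s) (supp x)
  have hc4 := Finset.card_union_le (supp u₂) (supp s)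
  have h1 := h.l2_res_sdiff_le hδ rfl hu (T := supp x ∪ supp s) (R := supp x ∪ supp s)
    (by omega) (supp_sub x s) (fun i h1 h2 => absurd h1 h2) (by omega) subset_rfl
  have h2 : l2 (res (supp u₂ ∪ supp s)ᶜ x) ≤
      l2 (res ((supp x ∪ supp s) \ supp u₂) (x - s)) := by
    refine l2_mono fun i => ?_
    by_cases hi : s i = 0
    · by_cases hi' : x i = 0 <;> by_cases hi2 : u₂ i = 0 <;> simp [res, mem_supp, hi, hi', hi2]
    · simp [res, mem_supp, hi]
  have h3 := h.l2_sub_lsOn_le hδ hδ1 (S := supp u₂ ∪ supp s) (x := x) (by omega) e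
  set b := lsOn A (supp u₂ ∪ supp s) (A *ᵥ x + e)
  have h4 := hs'.2 x hx
  have h5 := l2_add_le (x - b) (b - s')
  rw [sub_add_sub_cancel] at h5
  rw [l2_sub_comm b x] at h4
  have hq : 0 < 1 - δ := by linarith
  have h6 : l2 (x - s') ≤
      2 * (1 / (1 - δ) * (2 * δ * l2 (x - s) + 2 * √(1 + δ) * l2 e) + l2 e / √(1 - δ)) := by
    have : 1 / (1 - δ) * l2 (res (supp u₂ ∪ supp s)ᶜ x) ≤
        1 / (1 - δ) * (2 * δ * l2 (x - s) + 2 * √(1 + δ) * l2 e) :=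
      mul_le_mul_of_nonneg_left (h2.trans h1) (by positivity)
    linarith
  refine h6.trans (le_of_eq ?_)
  ring

theorem RIP.sp_error_le (h : RIP A (3 * K) δ) (hδ : 0 ≤ δ) (hδ1 : δ < 1) {x : Fin N → ℝ}
    {S : Finset (Fin N)} (hx : IsSparse K x) (hS : S.card ≤ K) (e : Fin M → ℝ) :
    l2 (x - lsOn A S (A *ᵥ x + e)) ≤ 1 / (1 - δ) * l2 (res Sᶜ x) + l2 e / √(1 - δ) := by
  unfold IsSparse at hx
  have hc := Finset.card_union_le S (supp x)
  exact h.l2_sub_lsOn_le hδ hδ1 (by omega) e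

/-- The contracting quantity is the energy of `x` off the support estimate. Correlations vanish on
`S` by the normal equations, so `K` new indices compete with `supp x` alone and level `3K` suffices.
Pruning discards entries of `b` no larger in norm than those kept outside `supp x`, which are pure
least-squares error. -/
theorem RIP.sp_step (h : RIP A (3 * K) δ) (hδ : 0 ≤ δ) (hδ1 : δ < 1) {x u₁ p : Fin N → ℝ}
    {S : Finset (Fin N)} (hx : IsSparse K x) (hS : S.card ≤ K) (e : Fin M → ℝ)
    (hu : IsBestApprox K (Aᵀ *ᵥ (A *ᵥ x + e - A *ᵥ lsOn A S (A *ᵥ x + e))) u₁)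
    (hp : IsBestApprox K (lsOn A (supp u₁ ∪ S) (A *ᵥ x + e)) p) :
    l2 (res (supp p)ᶜ x) ≤ (1 + δ) / (1 - δ) * (2 * δ / (1 - δ)) * l2 (res Sᶜ x)
      + ((1 + δ) / (1 - δ) * (2 * δ / √(1 - δ) + 2 * √(1 + δ)) + 2 / √(1 - δ)) * l2 e := by
  have hres := h.sp_error_le hδ hδ1 hx hS e
  unfold IsSparse at hx
  have hu1 : (supp u₁).card ≤ K := hu.1
  have hsupp := supp_lsOn A S (A *ᵥ x + e)
  have horth : ∀ i ∈ S, (Aᵀ *ᵥ (A *ᵥ x + e - A *ᵥ lsOn A S (A *ᵥ x + e))) i = 0 :=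
    fun i hi => transpose_mulVec_sub_lsOn A S _ hi
  set s := lsOn A S (A *ᵥ x + e)
  have hr : A *ᵥ x + e - A *ᵥ s = A *ᵥ (x - s) + e := by rw [mulVec_sub]; abel
  rw [hr] at hu horth
  have hc1 := Finset.card_union_le (supp x) S
  have hc2 := Finset.card_union_le (supp u₁) (supp x ∪ S)
  have hc3 := Finset.card_union_le (supp u₁ ∪ S) (supp x)
  have hc4 := Finset.card_union_le (supp u₁) S
  have h1 := h.l2_res_sdiff_le hδ rfl hu (T := supp x) (R := supp x ∪ S) hx
    ((supp_sub x s).trans (Finset.union_subset_union subset_rfl hsupp))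
    (fun i hi hi' => horth i ((Finset.mem_union.1 hi).resolve_left hi')) (by omega)
    Finset.subset_union_left
  have h2 : l2 (res (supp u₁ ∪ S)ᶜ x) ≤ l2 (res (supp x \ supp u₁) (x - s)) := by
    refine l2_mono fun i => ?_
    by_cases hi : i ∈ S
    · simp [res, hi]
    · have hsi := supp_subset_iff.1 hsupp i hi
      by_cases hi' : x i = 0 <;> by_cases hi2 : u₁ i = 0 <;> simp [res, mem_supp, hi, hsi, hi', hi2]
  have h3 := h.l2_res_sub_lsOn_le hδ hδ1 (S := supp u₁ ∪ S) (x := x) (by omega) e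
  have hbs := supp_lsOn A (supp u₁ ∪ S) (A *ᵥ x + e)
  set Q := supp u₁ ∪ S
  set b := lsOn A Q (A *ᵥ x + e)
  have h4 := hp.l2_sdiff_le hx
  have h5 : l2 (res (supp p \ supp x) b) ≤ l2 (res Q (x - b)) := by
    refine l2_mono fun i => ?_
    by_cases hi : x i = 0
    · by_cases hiQ : i ∈ Q
      · simp only [res, hiQ, if_true, Pi.sub_apply, hi, zero_sub, abs_neg]
        split_ifs <;> simp
      · have := supp_subset_iff.1 hbs i hiQ
        simp [res, this]
    · simp [res, mem_supp, hi]
  -- The discarded part of `x` splits into what lies off `Q`, the pruned entries of `b`, and the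
  -- least-squares error on `Q`.
  have h6 : l2 (res (supp p)ᶜ x) ≤
      l2 (res Qᶜ x) + (l2 (res (supp x \ supp p) b) + l2 (res Q (x - b))) := by
    refine le_trans (l2_mono fun i => ?_) ((l2_add_le (res Qᶜ x)
      (res (supp x \ supp p) b + res (Q \ supp p) (res (supp x) (x - b)))).trans
      (add_le_add le_rfl ((l2_add_le _ _).trans (add_le_add le_rfl (l2_mono fun i => ?_)))))
    · by_cases hi : x i = 0
      · simp [res, hi]
      · by_cases hiQ : i ∈ Q
        · by_cases hip : p i = 0 <;> simp [res, mem_supp, hi, hiQ, hip]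
        · have := supp_subset_iff.1 hbs i hiQ
          by_cases hip : p i = 0 <;> simp [res, mem_supp, hi, hiQ, hip, this]
    · by_cases hiQ : i ∈ Q
      · by_cases hip : p i = 0 <;> by_cases hi : x i = 0 <;> simp [res, mem_supp, hi, hiQ, hip]
      · simp [res, hiQ]
  have hq : 0 < 1 - δ := by linarith
  have h7 : (1 + δ) / (1 - δ) = 1 + 2 * (δ / (1 - δ)) := by field_simp; ring
  have h8 : l2 (res (supp p)ᶜ x) ≤ (1 + δ) / (1 - δ) * l2 (res Qᶜ x) + 2 * (l2 e / √(1 - δ)) := by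
    rw [h7]; linarith
  have h9 : l2 (res Qᶜ x) ≤ 2 * δ * (1 / (1 - δ) * l2 (res Sᶜ x) + l2 e / √(1 - δ))
      + 2 * √(1 + δ) * l2 e :=
    (h2.trans h1).trans (by gcongr)
  have h10 : (1 + δ) / (1 - δ) * l2 (res Qᶜ x) ≤ (1 + δ) / (1 - δ) *
      (2 * δ * (1 / (1 - δ) * l2 (res Sᶜ x) + l2 e / √(1 - δ)) + 2 * √(1 + δ) * l2 e) := by
    gcongr
  refine h8.trans ((add_le_add h10 le_rfl).trans (le_of_eq ?_))
  ring

/-- Off `B = supp x ∪ supp s'` both `x` and `s'` vanish, so `s'` is also at least as close as `x` to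
`v` restricted to `B`. The error is then at most twice `x - v` on `B`. -/
theorem RIP.iht_step (h : RIP A (3 * K) δ) (hδ : 0 ≤ δ) {x s s' : Fin N → ℝ}
    (hx : IsSparse K x) (hs : IsSparse K s) (e : Fin M → ℝ)
    (hs' : IsBestApprox K (s + Aᵀ *ᵥ (A *ᵥ x + e - A *ᵥ s)) s') :
    l2 (x - s') ≤ 2 * δ * l2 (x - s) + 2 * √(1 + δ) * l2 e := by
  have hs1 : (supp s').card ≤ K := hs'.1
  have hr : A *ᵥ x + e - A *ᵥ s = A *ᵥ (x - s) + e := by rw [mulVec_sub]; abel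
  rw [hr] at hs'
  set v := s + Aᵀ *ᵥ (A *ᵥ (x - s) + e) with hv
  have hxK := hx
  unfold IsSparse at hx hs
  set B := supp x ∪ supp s' with hB
  have hc1 : B.card ≤ _ := Finset.card_union_le (supp x) (supp s')
  have hc2 := Finset.card_union_le B (supp s)
  have hc3 : (B ∪ supp (x - s)).card ≤ (B ∪ supp s).card := Finset.card_le_card <|
    Finset.union_subset Finset.subset_union_left ((supp_sub x s).trans
      (Finset.union_subset_union Finset.subset_union_left subset_rfl))
  have h1 := h.l2_res_sub_corr_le hδ (B := B) (r := x - s) (by omega) e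
  have h2 : x - s - Aᵀ *ᵥ (A *ᵥ (x - s) + e) = x - v := by rw [hv]; abel
  rw [h2, res_sub, res_eq_self (v := x) Finset.subset_union_left] at h1
  have h3 : l2 (res B v - s') ≤ l2 (res B v - x) := by
    have h4 := hs'.2 x hxK
    have split : ∀ w : Fin N → ℝ, supp w ⊆ B →
        l2 (res B v - w) ^ 2 + l2 (res Bᶜ v) ^ 2 = l2 (v - w) ^ 2 := by
      intro w hw
      rw [← l2_sq_res_add_compl B (v - w), res_sub, res_sub, res_eq_self hw]
      congr 3
      funext i
      by_cases hi : i ∈ B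
      · simp [res, hi]
      · simp [res, supp_subset_iff.1 hw i hi]
    apply l2_le_of_sq_le_sq
    have := pow_le_pow_left₀ (l2_nonneg _) h4 2
    have := split s' Finset.subset_union_right
    have := split x Finset.subset_union_left
    linarith
  rw [l2_sub_comm _ x] at h3
  have h5 := l2_add_le (x - res B v) (res B v - s')
  rw [sub_add_sub_cancel] at h5
  linarith

theorem RIP.cosamp_bound (h : RIP A (4 * K) δ) (hδ : 0 < δ) (hc : δ ≤ Pursuit.CoSaMP.c)
    {x : Fin N → ℝ} (hx : IsSparse K x) (e : Fin M → ℝ) {s : ℕ → Fin N → ℝ}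
    (hs : IsCoSaMPRun A (A *ᵥ x + e) K s) (l : ℕ) :
    l2 (x - s l) ≤ Pursuit.CoSaMP.a * Pursuit.CoSaMP.C δ ^ l * l2 x
      + Pursuit.CoSaMP.D δ * l2 e := by
  have hC0 := Pursuit.C_pos .CoSaMP hδ hc
  have hC1 := Pursuit.C_lt_one .CoSaMP hδ hc
  simp only [Pursuit.C, Pursuit.D, Pursuit.a, Pursuit.c] at *
  norm_num at hc
  have hq : 0 < 1 - δ := by linarith
  have he := l2_nonneg e
  obtain ⟨h0, hstep⟩ := hs
  have hsp : ∀ l, IsSparse K (s l) := by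
    rintro (_ | l)
    · simp [h0, IsSparse, supp]
    · obtain ⟨_, _, h2⟩ := hstep l
      exact h2.1
  -- The denominators are relaxed to `(1 - δ)²` so that division by `1 - C` gives `D`: `(1 - δ)² -
  -- 4δ = 1 - 6δ + δ²`.
  have hD1 : 4 * √(1 + δ) / (1 - δ) + 2 / √(1 - δ) ≤ (6 + 2 * δ) / (1 - δ) ^ 2 := by
    have h1 := sqrt_one_add_le hδ.le
    have h2 : 2 / √(1 - δ) ≤ 2 / (1 - δ) :=
      div_le_div_of_nonneg_left (by norm_num) hq (one_sub_le_sqrt hδ.le (by linarith))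
    have h3 : (4 * √(1 + δ) + 2) / (1 - δ) ≤ (6 + 2 * δ) / (1 - δ) :=
      div_le_div_of_nonneg_right (by linarith) hq.le
    have h4 : (6 + 2 * δ) / (1 - δ) ≤ (6 + 2 * δ) / (1 - δ) ^ 2 := by
      refine div_le_div_of_nonneg_left (by linarith) (by positivity) ?_
      nlinarith
    rw [add_div] at h3
    linarith
  have hC : 4 * δ / (1 - δ) ≤ 4 * δ / (1 - δ) ^ 2 := by
    refine div_le_div_of_nonneg_left (by linarith) (by positivity) ?_
    nlinarith
  have hrec : ∀ l, l2 (x - s (l + 1)) ≤ 4 * δ / (1 - δ) ^ 2 * l2 (x - s l)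
      + (6 + 2 * δ) / (1 - δ) ^ 2 * l2 e := by
    intro l
    obtain ⟨u₂, hu, hs'⟩ := hstep l
    refine (h.cosamp_step hδ.le (by linarith) hx (hsp l) e hu hs').trans ?_
    have := l2_nonneg (x - s l)
    gcongr
  have := geometric_bound (z := fun l => l2 (x - s l)) hC0.le hC1
    (mul_nonneg (by positivity) he) hrec l
  simp only [h0, sub_zero] at this
  rw [one_mul]
  refine this.trans (le_of_eq ?_)
  congr 1
  rw [div_lt_one (by positivity)] at hC1
  have h5 : (1 - δ) ^ 2 - 4 * δ ≠ 0 := by linarith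
  have h6 : 1 - 6 * δ + δ ^ 2 = (1 - δ) ^ 2 - 4 * δ := by ring
  have h7 : 1 - 4 * δ / (1 - δ) ^ 2 = ((1 - δ) ^ 2 - 4 * δ) / (1 - δ) ^ 2 := by field_simp
  rw [h6, h7]
  field_simp

theorem RIP.iht_bound (h : RIP A (3 * K) δ) (hδ : 0 < δ) (hc : δ ≤ Pursuit.IHT.c)
    {x : Fin N → ℝ} (hx : IsSparse K x) (e : Fin M → ℝ) {s : ℕ → Fin N → ℝ}
    (hs : IsIHTRun A (A *ᵥ x + e) K s) (l : ℕ) :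
    l2 (x - s l) ≤ Pursuit.IHT.a * Pursuit.IHT.C δ ^ l * l2 x + Pursuit.IHT.D δ * l2 e := by
  have hC0 := Pursuit.C_pos .IHT hδ hc
  have hC1 := Pursuit.C_lt_one .IHT hδ hc
  simp only [Pursuit.C, Pursuit.D, Pursuit.a, Pursuit.c] at *
  have he := l2_nonneg e
  obtain ⟨h0, hstep⟩ := hs
  have hsp : ∀ l, IsSparse K (s l) := by
    rintro (_ | l)
    · simp [h0, IsSparse, supp]
    · exact (hstep l).1
  -- The step contracts by `2δ`; the stated factor `√8 δ` is weaker.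
  have h8 : (2 : ℝ) ≤ √8 := Real.le_sqrt_of_sq_le (by norm_num)
  have hrec : ∀ l, l2 (x - s (l + 1)) ≤ √8 * δ * l2 (x - s l) + 2 * √(1 + δ) * l2 e := by
    intro l
    refine (h.iht_step hδ.le hx (hsp l) e (hstep l)).trans ?_
    have := l2_nonneg (x - s l)
    gcongr
  have := geometric_bound (z := fun l => l2 (x - s l)) hC0.le hC1
    (mul_nonneg (by positivity) he) hrec l
  simp only [h0, sub_zero] at this
  rw [one_mul]
  refine this.trans (le_of_eq ?_)
  ring

theorem RIP.sp_bound (h : RIP A (3 * K) δ) (hδ : 0 < δ) (hc : δ ≤ Pursuit.SP.c)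
    {x : Fin N → ℝ} (hx : IsSparse K x) (e : Fin M → ℝ) {s : ℕ → Fin N → ℝ}
    (hs : IsSPRun A (A *ᵥ x + e) K s) (l : ℕ) :
    l2 (x - s l) ≤ Pursuit.SP.a * Pursuit.SP.C δ ^ l * l2 x + Pursuit.SP.D δ * l2 e := by
  have hC0 := Pursuit.C_pos .SP hδ hc
  have hC1 := Pursuit.C_lt_one .SP hδ hc
  simp only [Pursuit.C, Pursuit.D, Pursuit.a, Pursuit.c] at *
  norm_num at hc
  have hq : 0 < 1 - δ := by linarith
  have he := l2_nonneg e
  obtain ⟨S, ⟨u₀, hu₀, hS0⟩, hsl, hstep⟩ := hs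
  have hScard : ∀ l, (S l).card ≤ K := by
    rintro (_ | l)
    · rw [hS0]; exact hu₀.1
    · obtain ⟨_, p, _, hp, hS⟩ := hstep l
      rw [hS]; exact hp.1
  set C := (2 * δ + 2 * δ ^ 2) / (1 - δ) ^ 3 with hCdef
  -- Chosen so that `(η / (1 - C) + 1) / (1 - δ)` is exactly `D`.
  set η := (4 + δ - 9 * δ ^ 2 + δ ^ 3 - δ ^ 4) / (1 - δ) ^ 3 with hη
  have hCle : (1 + δ) / (1 - δ) * (2 * δ / (1 - δ)) ≤ C := by
    have h1 : (1 + δ) / (1 - δ) * (2 * δ / (1 - δ)) = (2 * δ + 2 * δ ^ 2) / (1 - δ) ^ 2 := by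
      field_simp
    rw [h1]
    refine div_le_div_of_nonneg_left (by positivity) (by positivity) ?_
    exact pow_le_pow_of_le_one hq.le (by linarith) (by norm_num)
  have hsq : 1 / √(1 - δ) ≤ 1 / (1 - δ) :=
    div_le_div_of_nonneg_left (by norm_num) hq (one_sub_le_sqrt hδ.le (by linarith))
  have hηle : (1 + δ) / (1 - δ) * (2 * δ / √(1 - δ) + 2 * √(1 + δ)) + 2 / √(1 - δ) ≤ η := by
    have h1 := sqrt_one_add_le hδ.le
    have h2 : 2 * δ / √(1 - δ) = 2 * δ * (1 / √(1 - δ)) := by ring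
    have h3 : 2 / √(1 - δ) = 2 * (1 / √(1 - δ)) := by ring
    have h4 : (1 + δ) / (1 - δ) * (2 * δ / √(1 - δ) + 2 * √(1 + δ)) + 2 / √(1 - δ) ≤
        (1 + δ) / (1 - δ) * (2 * δ * (1 / (1 - δ)) + 2 * (1 + δ / 2)) + 2 * (1 / (1 - δ)) := by
      rw [h2, h3]; gcongr
    refine h4.trans ?_
    have h5 : (1 + δ) / (1 - δ) * (2 * δ * (1 / (1 - δ)) + 2 * (1 + δ / 2)) + 2 * (1 / (1 - δ)) =
        ((1 + δ) * (1 - δ) * (2 * δ) + (1 + δ) * (1 - δ) ^ 2 * (2 + δ) + 2 * (1 - δ) ^ 2)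
          / (1 - δ) ^ 3 := by
      field_simp
    rw [h5, hη]
    gcongr
    -- The numerators differ by `4δ - 8δ² + 2δ³ - 2δ⁴`.
    have : 0 ≤ δ * (0.206 - δ) := mul_nonneg hδ.le (by norm_num; linarith)
    nlinarith [mul_nonneg hδ.le this, mul_nonneg (mul_nonneg hδ.le hδ.le) this]
  have hη0 : 0 ≤ η := le_trans (by positivity) hηle
  have hrec : ∀ l, l2 (res (S (l + 1))ᶜ x) ≤ C * l2 (res (S l)ᶜ x) + η * l2 e := by
    intro l
    obtain ⟨u₁, p, hu, hp, hS⟩ := hstep l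
    rw [hsl l] at hu
    rw [hS]
    refine (h.sp_step hδ.le (by linarith) hx (hScard l) e hu hp).trans ?_
    have := l2_nonneg (res (S l)ᶜ x)
    gcongr
  have h1 := geometric_bound (z := fun l => l2 (res (S l)ᶜ x)) hC0.le hC1
    (mul_nonneg (by positivity) he) hrec l
  have h2 := h.sp_error_le hδ.le (by linarith) hx (hScard l) e
  have h3 : l2 (res (S l)ᶜ x) ≤ C ^ l * l2 x + η * l2 e / (1 - C) :=
    h1.trans (by have := l2_res_le (S 0)ᶜ x; gcongr)
  rw [← hsl l] at h2
  have hx0 : 0 ≤ C ^ l * l2 x := mul_nonneg (pow_nonneg hC0.le l) (l2_nonneg x)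
  -- Origin of `a`: `1 / (1 - 0.206) < 1.26`.
  have h4 : 1 / (1 - δ) ≤ 1.26 := by
    rw [div_le_iff₀ hq]; norm_num; linarith
  have hden : 0 < (1 - δ) ^ 3 - (2 * δ + 2 * δ ^ 2) := by
    rw [hCdef, div_lt_one (by positivity)] at hC1
    linarith
  have h5 : (5 - 4 * δ - 8 * δ ^ 2 - δ ^ 4) / (1 - 6 * δ + 6 * δ ^ 2 - 2 * δ ^ 3 + δ ^ 4) =
      1 / (1 - δ) * (η / (1 - C)) + 1 / (1 - δ) := by
    have e1 : 1 - 6 * δ + 6 * δ ^ 2 - 2 * δ ^ 3 + δ ^ 4 =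
        (1 - δ) * ((1 - δ) ^ 3 - (2 * δ + 2 * δ ^ 2)) := by ring
    have e2 : 1 - C = ((1 - δ) ^ 3 - (2 * δ + 2 * δ ^ 2)) / (1 - δ) ^ 3 := by
      rw [hCdef]; field_simp
    have e3 : η / (1 - C) = (4 + δ - 9 * δ ^ 2 + δ ^ 3 - δ ^ 4) /
        ((1 - δ) ^ 3 - (2 * δ + 2 * δ ^ 2)) := by
      rw [e2, hη, div_div_div_cancel_right₀ (by positivity)]
    rw [e1, e3]
    have := hden.ne'
    generalize hd : (1 - δ) ^ 3 - (2 * δ + 2 * δ ^ 2) = d at *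
    field_simp
    rw [← hd]
    ring
  calc l2 (x - s l) ≤ 1 / (1 - δ) * (C ^ l * l2 x + η * l2 e / (1 - C)) + l2 e / √(1 - δ) :=
        h2.trans (by gcongr)
    _ ≤ 1 / (1 - δ) * (C ^ l * l2 x) + 1 / (1 - δ) * (η * l2 e / (1 - C)) + 1 / (1 - δ) * l2 e := by
        have := mul_le_mul_of_nonneg_right hsq he
        rw [one_div_mul_eq_div] at this
        linarith
    _ ≤ 1.26 * (C ^ l * l2 x) + (1 / (1 - δ) * (η / (1 - C)) + 1 / (1 - δ)) * l2 e := by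
        have := mul_le_mul_of_nonneg_right h4 hx0
        have e4 : η * l2 e / (1 - C) = η / (1 - C) * l2 e := by ring
        rw [e4]
        linarith
    _ = _ := by rw [h5]; ring

/-- Error bound of all three pursuits for measurements `A x + e` of a `K`-sparse `x`. -/
theorem Pursuit.error_le (alg : Pursuit) (h : RIP A (alg.b * K) δ) (hδ : 0 < δ) (hc : δ ≤ alg.c)
    {x : Fin N → ℝ} (hx : IsSparse K x) (e : Fin M → ℝ) {s : ℕ → Fin N → ℝ}
    (hs : alg.IsRun A (A *ᵥ x + e) K s) (l : ℕ) :
    l2 (x - s l) ≤ alg.a * alg.C δ ^ l * l2 x + alg.D δ * l2 e := by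
  cases alg
  · exact RIP.cosamp_bound h hδ hc hx e hs l
  · exact RIP.sp_bound h hδ hc hx e hs l
  · exact RIP.iht_bound h hδ hc hx e hs l

end

/-! ### Norms of column submatrices and compressible vectors -/

section

variable {M N : ℕ} {A : Matrix (Fin M) (Fin N) ℝ} {K : ℕ}

theorem bddAbove_colNorm (A : Matrix (Fin M) (Fin N) ℝ) (K : ℕ) :
    BddAbove {r : ℝ | ∃ S : Finset (Fin N), S.card = K ∧ r = ‖colSub A S‖} := by
  refine ((Set.finite_range fun S : Finset (Fin N) => ‖colSub A S‖).subset ?_).bddAbove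
  rintro r ⟨S, -, rfl⟩
  exact ⟨S, rfl⟩

theorem colNorm_nonneg (A : Matrix (Fin M) (Fin N) ℝ) (K : ℕ) : 0 ≤ colNorm A K :=
  Real.sSup_nonneg fun _ ⟨_, _, hr⟩ => hr ▸ norm_nonneg _

theorem l2_mulVec_le_colNorm (hKN : K ≤ N) {v : Fin N → ℝ} (hv : IsSparse K v) :
    l2 (A *ᵥ v) ≤ colNorm A K * l2 v := by
  -- `colNorm` uses exactly `K` columns, so the support is enlarged; this needs `K ≤ N`.
  obtain ⟨S, hS, hSK⟩ := Finset.exists_superset_card_eq hv (by simpa using hKN)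
  rw [mulVec_eq_colSub_mulVec A hS]
  have h1 : ‖colSub A S‖ ≤ colNorm A K := le_csSup (bddAbove_colNorm A K) ⟨S, hSK, rfl⟩
  have h2 : l2 (fun i : S => v i) ≤ l2 v := by
    apply l2_le_of_sq_le_sq
    rw [l2_sq_eq_sum, l2_sq_eq_sum, Finset.sum_coe_sort S fun i => v i ^ 2]
    exact Finset.sum_le_univ_sum_of_nonneg fun i => sq_nonneg _
  exact (l2_mulVec_le _ _).trans (mul_le_mul h1 h2 (l2_nonneg _) (colNorm_nonneg A K))

theorem RIP.colNorm_le {δ : ℝ} (h : RIP A K δ) : colNorm A K ≤ √(1 + δ) := by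
  refine Real.sSup_le ?_ (Real.sqrt_nonneg _)
  rintro _ ⟨S, hS, rfl⟩
  rw [Matrix.l2_opNorm_def]
  refine ContinuousLinearMap.opNorm_le_bound _ (Real.sqrt_nonneg _) fun w => ?_
  set v : Fin N → ℝ := fun i => if hi : i ∈ S then w ⟨i, hi⟩ else 0 with hvdef
  have hv : supp v ⊆ S := supp_subset_iff.2 fun i hi => by simp [hvdef, hi]
  have hvw : (fun i : S => v i) = WithLp.ofLp w := by
    funext i; simp [hvdef]
  have h1 := h.l2_mulVec_le (IsSparse.of_supp_subset hv hS.le)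
  rw [mulVec_eq_colSub_mulVec A hv, hvw] at h1
  have h2 : l2 v = ‖w‖ := by
    have h3 : l2 v ^ 2 = l2 (WithLp.ofLp w) ^ 2 := by
      rw [← res_eq_self hv, l2_sq_res, l2_sq_eq_sum, ← hvw, Finset.sum_coe_sort S fun i => v i ^ 2]
    exact (sq_eq_sq₀ (l2_nonneg _) (norm_nonneg _)).1 h3
  rw [h2] at h1
  exact h1

theorem exists_largest (h : Fin N → ℝ) {k : ℕ} (hk : k ≤ N) :
    ∃ T : Finset (Fin N), T.card = k ∧ ∀ i ∈ T, ∀ j ∉ T, |h j| ≤ |h i| := by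
  induction k with
  | zero => exact ⟨∅, rfl, by simp⟩
  | succ k ih =>
    obtain ⟨T, hT, hmax⟩ := ih (by omega)
    have hne : (Tᶜ).Nonempty := by
      rw [← Finset.card_pos, Finset.card_compl, Fintype.card_fin]; omega
    obtain ⟨m, hm, hmle⟩ := Finset.exists_max_image Tᶜ (fun i => |h i|) hne
    have hmT : m ∉ T := Finset.mem_compl.1 hm
    refine ⟨insert m T, by rw [Finset.card_insert_of_notMem hmT, hT], fun i hi j hj => ?_⟩
    simp only [Finset.mem_insert, not_or] at hi hj
    rcases hi with rfl | hi
    · exact hmle j (Finset.mem_compl.2 hj.2)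
    · exact hmax i hi j hj.2

/-- The largest `K` entries of `h`, with a threshold separating them from the rest. -/
theorem exists_largest_threshold (hK : 1 ≤ K) (hKN : K ≤ N) (h : Fin N → ℝ) :
    ∃ (T : Finset (Fin N)) (m : ℝ), T.card = K ∧ 0 ≤ m ∧ (∀ j, |res Tᶜ h j| ≤ m) ∧
      K * m ≤ l1 (res T h) ∧ l1 (res T h) + l1 (res Tᶜ h) = l1 h ∧
      (¬ IsSparse K h → (supp (res Tᶜ h)).card < (supp h).card) := by
  obtain ⟨T, hT, hmax⟩ := exists_largest h hKN
  obtain ⟨i₀, hi₀, hmin⟩ := Finset.exists_min_image T (fun i => |h i|)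
    (Finset.card_pos.1 (by omega))
  refine ⟨T, |h i₀|, hT, abs_nonneg _, fun j => ?_, ?_, ?_, fun hns => ?_⟩
  · by_cases hj : j ∈ T
    · simp [res, hj]
    · simpa [res, hj] using hmax i₀ hi₀ j hj
  · have h1 : l1 (res T h) = ∑ i ∈ T, |h i| := by
      simp [l1_eq_sum, res, apply_ite abs, Finset.sum_ite_mem]
    rw [h1, ← hT, ← nsmul_eq_mul]
    exact Finset.card_nsmul_le_sum T _ _ hmin
  · simp only [l1_eq_sum, ← Finset.sum_add_distrib]
    refine Finset.sum_congr rfl fun i _ => ?_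
    by_cases hi : i ∈ T <;> simp [res, hi]
  · refine Finset.card_lt_card (Finset.ssubset_iff_subset_ne.2 ⟨?_, fun heq => ?_⟩)
    · refine supp_subset_iff.2 fun i hi => ?_
      have : h i = 0 := by simpa [mem_supp] using hi
      simp [res, this]
    · have hT0 : ∀ i ∈ T, h i = 0 := by
        intro i hi
        by_contra hne
        have := heq ▸ mem_supp.2 hne
        simp [mem_supp, res, hi] at this
      have : h = 0 := by
        funext j
        by_cases hj : j ∈ T
        · exact hT0 j hj
        · have := hmax i₀ hi₀ j hj
          rw [hT0 i₀ hi₀, abs_zero] at this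
          exact abs_nonpos_iff.1 this
      exact hns (by simp [this, IsSparse, supp])

theorem l1_nonneg (v : Fin N → ℝ) : 0 ≤ l1 v := norm_nonneg _

theorem l2_le_sqrt_mul_of_abs_le {v : Fin N → ℝ} {m : ℝ} (hm : 0 ≤ m) (hv : IsSparse K v)
    (h : ∀ i, |v i| ≤ m) : l2 v ≤ √K * m := by
  have h1 : l2 v ^ 2 ≤ K * m ^ 2 := by
    rw [← res_eq_self (subset_refl (supp v)), l2_sq_res]
    calc ∑ i ∈ supp v, v i ^ 2 ≤ ∑ i ∈ supp v, m ^ 2 :=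
          Finset.sum_le_sum fun i _ => sq_le_sq' (abs_le.1 (h i)).1 (abs_le.1 (h i)).2
      _ = (supp v).card * m ^ 2 := by rw [Finset.sum_const, nsmul_eq_mul]
      _ ≤ K * m ^ 2 := by
          have : ((supp v).card : ℝ) ≤ K := by exact_mod_cast hv
          gcongr
  refine abs_le_of_sq_le_sq' ?_ (by positivity) |>.2
  rwa [mul_pow, Real.sq_sqrt (Nat.cast_nonneg K)]

theorem sqrt_mul_le_div_sqrt (hK : 1 ≤ K) {m t : ℝ} (h : K * m ≤ t) : √K * m ≤ t / √K := by
  have hK' : (0 : ℝ) < K := by exact_mod_cast hK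
  rw [le_div_iff₀ (Real.sqrt_pos.2 hK')]
  calc √K * m * √K = √K * √K * m := by ring
    _ = K * m := by rw [Real.mul_self_sqrt hK'.le]
    _ ≤ t := h

/-- Peel off the `K` largest entries. The block has norm at most `√K m`, and the threshold `m'` for
the rest satisfies `√K m' ≤ ‖block‖₁ / √K`, so the sum telescopes into the `ℓ₁` norm. The induction
is on the support size. -/
theorem l2_mulVec_le_of_abs_le {β : ℝ} (hβ : 0 ≤ β) (hK : 1 ≤ K) (hKN : K ≤ N)
    (hA : ∀ v : Fin N → ℝ, IsSparse K v → l2 (A *ᵥ v) ≤ β * l2 v) (n : ℕ) :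
    ∀ (h : Fin N → ℝ) (m : ℝ), (supp h).card ≤ n → 0 ≤ m → (∀ i, |h i| ≤ m) →
      l2 (A *ᵥ h) ≤ β * (√K * m + l1 h / √K) := by
  induction n with
  | zero =>
    intro h m hn hm _
    have : h = 0 := by
      funext i
      by_contra hi
      exact Finset.notMem_empty i ((Finset.card_eq_zero.1 (Nat.le_zero.1 hn)) ▸ mem_supp.2 hi)
    have := l1_nonneg h
    simp only [‹h = 0›, mulVec_zero, l2_zero] at *
    positivity
  | succ n ih =>
    intro h m hn hm hhm
    have hl := l1_nonneg h
    by_cases hsp : IsSparse K h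
    · have h1 := l2_le_sqrt_mul_of_abs_le hm hsp hhm
      have : 0 ≤ l1 h / √K := by positivity
      exact (hA h hsp).trans (mul_le_mul_of_nonneg_left (by linarith) hβ)
    · obtain ⟨T, m', hT, hm', hle, hKm, hsum, hcard⟩ := exists_largest_threshold hK hKN h
      have hTs : IsSparse K (res T h) := IsSparse.of_supp_subset (supp_res T h) hT.le
      have h1 := l2_le_sqrt_mul_of_abs_le hm hTs fun i => by
        by_cases hi : i ∈ T
        · simpa [res, hi] using hhm i
        · simpa [res, hi] using hm
      have h2 := ih (res Tᶜ h) m' (by have := hcard hsp; omega) hm' hle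
      have h3 := sqrt_mul_le_div_sqrt hK hKm
      have h4 := l2_add_le (A *ᵥ res T h) (A *ᵥ res Tᶜ h)
      rw [← mulVec_add, res_add_res_compl] at h4
      have h5 := hA _ hTs
      rw [← hsum, add_div]
      have h6 := mul_le_mul_of_nonneg_left h1 hβ
      have h7 := mul_le_mul_of_nonneg_left h3 hβ
      linarith

/-- A bound on sparse vectors extends to all vectors with an additional `ℓ₁` term. -/
theorem l2_mulVec_le_of_sparse {β : ℝ} (hβ : 0 ≤ β) (hK : 1 ≤ K) (hKN : K ≤ N)
    (hA : ∀ v : Fin N → ℝ, IsSparse K v → l2 (A *ᵥ v) ≤ β * l2 v) (h : Fin N → ℝ) :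
    l2 (A *ᵥ h) ≤ β * (l2 h + l1 h / √K) := by
  obtain ⟨T, m', hT, hm', hle, hKm, hsum, -⟩ := exists_largest_threshold hK hKN h
  have h1 := hA _ (IsSparse.of_supp_subset (supp_res T h) hT.le)
  have h2 := l2_mulVec_le_of_abs_le hβ hK hKN hA _ (res Tᶜ h) m' le_rfl hm' hle
  have h3 := mul_le_mul_of_nonneg_left (sqrt_mul_le_div_sqrt hK hKm) hβ
  have h4 := l2_add_le (A *ᵥ res T h) (A *ᵥ res Tᶜ h)
  rw [← mulVec_add, res_add_res_compl] at h4
  have h5 := mul_le_mul_of_nonneg_left (l2_res_le T h) hβ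
  rw [← hsum, add_div]
  linarith

/-- Constant zero at level 2 would make the columns orthonormal, hence `A` injective, impossible
with more columns than rows. -/
theorem RIP.const_pos (hMN : M < N) {k : ℕ} (hk : 2 ≤ k) {δ : ℝ} (hδ : 0 ≤ δ) (h : RIP A k δ) :
    0 < δ := by
  refine hδ.lt_of_ne fun h0 => ?_
  rw [← h0] at h
  have hle : ∀ v : Fin N → ℝ, Aᵀ *ᵥ (A *ᵥ v) = v := by
    have hG : Aᵀ * A = 1 := by
      have hcol : ∀ j, (Pi.single j 1 : Fin N → ℝ) - Aᵀ *ᵥ (A *ᵥ Pi.single j 1) = 0 := by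
        intro j
        funext i
        have hs : supp (Pi.single j 1 : Fin N → ℝ) ⊆ {j} := supp_subset_iff.2 fun i hi => by
          simp at hi; simp [hi]
        have h1 := h.l2_res_sub_le le_rfl (B := {i}) (r := Pi.single j 1)
          ((Finset.card_le_card (Finset.union_subset_union subset_rfl hs)).trans
            ((Finset.card_union_le _ _).trans (by simpa using hk)))
        rw [zero_mul] at h1
        have h2 := congrFun (l2_eq_zero (le_antisymm h1 (l2_nonneg _))) i
        simpa [res] using h2
      ext i j
      have h1 := congrFun (hcol j) i
      rw [mulVec_mulVec, mulVec_single_one] at h1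
      simp only [Pi.sub_apply, Pi.zero_apply, col_apply] at h1
      rw [Matrix.one_apply, ← sub_eq_zero.1 h1, Pi.single_apply]
    intro v
    rw [mulVec_mulVec, hG, one_mulVec]
  have hinj : Function.Injective A.mulVecLin :=
    Function.LeftInverse.injective (g := fun w => Aᵀ *ᵥ w) hle
  have := LinearMap.finrank_le_finrank_of_injective hinj
  simp at this
  omega

theorem colNorm_pos (hK : 1 ≤ K) (hKN : K ≤ N) (hA : A ≠ 0) : 0 < colNorm A K := by
  refine (colNorm_nonneg A K).lt_of_ne fun h0 => hA ?_
  ext i j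
  have hs : supp (Pi.single j 1 : Fin N → ℝ) ⊆ {j} := supp_subset_iff.2 fun i hi => by
    simp at hi; simp [hi]
  have h1 := l2_mulVec_le_colNorm (A := A) hKN (IsSparse.of_supp_subset hs (by simpa using hK))
  rw [← h0, zero_mul] at h1
  have h2 := congrFun (l2_eq_zero (le_antisymm h1 (l2_nonneg _))) i
  simpa using h2

end

/-! ### The relative error of the pursuits -/

theorem Pursuit.a_pos (alg : Pursuit) : 0 < alg.a := by
  cases alg <;> norm_num [Pursuit.a]

theorem Pursuit.three_le_b (alg : Pursuit) : 3 ≤ alg.b := by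
  cases alg <;> simp [Pursuit.b]

theorem Pursuit.D_nonneg (alg : Pursuit) {δ : ℝ} (hδ : 0 < δ) (hc : δ ≤ alg.c) :
    0 ≤ alg.D δ := by
  have hC := alg.C_lt_one hδ hc
  cases alg <;> simp only [Pursuit.C, Pursuit.c, Pursuit.D] at *
  · norm_num at hc
    have : 0 ≤ 1 - 6 * δ + δ ^ 2 := by
      have : 0 < 1 - δ := by linarith
      rw [div_lt_one (by positivity)] at hC
      nlinarith
    positivity
  · norm_num at hc
    have h1 : 0 < 1 - δ := by linarith
    rw [div_lt_one (by positivity)] at hC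
    refine div_nonneg ?_ ?_
    · have h2 : δ ^ 2 ≤ 1 / 16 := by nlinarith
      nlinarith [sq_nonneg δ]
    · have : 1 - 6 * δ + 6 * δ ^ 2 - 2 * δ ^ 3 + δ ^ 4 =
        (1 - δ) * ((1 - δ) ^ 3 - (2 * δ + 2 * δ ^ 2)) := by ring
      rw [this]
      exact mul_nonneg h1.le (by linarith)
  · exact div_nonneg (by positivity) (by linarith)

/-- The relative error changes by at most the condition number under a change of basis. -/
theorem l2_div_mulVec_le {N : ℕ} {Ψ : Matrix (Fin N) (Fin N) ℝ} (hΨ : IsUnit Ψ.det)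
    {s : Fin N → ℝ} (hs : s ≠ 0) (t : Fin N → ℝ) :
    l2 (Ψ *ᵥ s - Ψ *ᵥ t) / l2 (Ψ *ᵥ s) ≤ ‖Ψ‖ * ‖Ψ⁻¹‖ * (l2 (s - t) / l2 s) := by
  have h1 : l2 (Ψ *ᵥ s - Ψ *ᵥ t) ≤ ‖Ψ‖ * l2 (s - t) := by
    rw [← mulVec_sub]; exact l2_mulVec_le _ _
  have hinv : Ψ⁻¹ *ᵥ (Ψ *ᵥ s) = s := by
    rw [mulVec_mulVec, nonsing_inv_mul _ hΨ, one_mulVec]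
  have h2 : l2 s ≤ ‖Ψ⁻¹‖ * l2 (Ψ *ᵥ s) :=
    (congrArg l2 hinv).ge.trans (l2_mulVec_le Ψ⁻¹ (Ψ *ᵥ s))
  have h3 : 0 < l2 s := l2_pos hs
  have h4 : 0 < l2 (Ψ *ᵥ s) := by
    refine l2_pos fun h0 => hs ?_
    rw [← hinv, h0, mulVec_zero]
  rw [div_le_iff₀ h4]
  have h5 : 1 ≤ ‖Ψ⁻¹‖ * l2 (Ψ *ᵥ s) / l2 s := (one_le_div h3).2 h2
  have h6 : 0 ≤ ‖Ψ‖ * l2 (s - t) := mul_nonneg (norm_nonneg _) (l2_nonneg _)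
  calc l2 (Ψ *ᵥ s - Ψ *ᵥ t) ≤ ‖Ψ‖ * l2 (s - t) * (‖Ψ⁻¹‖ * l2 (Ψ *ᵥ s) / l2 s) :=
        h1.trans (le_mul_of_one_le_right h6 h5)
    _ = _ := by ring

/-- The total perturbation `e - E s_K + A (s - s_K)`, relative to `s`. -/
theorem l2_perturbation_le {M N K : ℕ} (hK : 1 ≤ K) (hKN : K ≤ N)
    {A E : Matrix (Fin M) (Fin N) ℝ} {s sK : Fin N → ℝ} (hsK : IsBestApprox K s sK)
    (hAs : A *ᵥ s ≠ 0) (e : Fin M → ℝ) :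
    l2 (e - E *ᵥ sK + A *ᵥ (s - sK)) ≤ √(1 + ric A K) *
      (l2 e / l2 (A *ᵥ s) + colNorm E K / colNorm A K + (1 + l2 e / l2 (A *ᵥ s)) *
        (l2 (s - sK) / l2 s + l1 (s - sK) / (√K * l2 s))) * l2 s := by
  have hs : s ≠ 0 := by rintro rfl; simp at hAs
  have hs0 := l2_pos hs
  have hy0 := l2_pos hAs
  have hA : A ≠ 0 := by rintro rfl; simp at hAs
  have hAc := colNorm_pos hK hKN hA
  have hrip := rip_ric A K
  have hβ := Real.sqrt_nonneg (1 + ric A K)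
  have hcol := hrip.colNorm_le
  have htail := l2_mulVec_le_of_sparse hβ hK hKN (fun v hv => hrip.l2_mulVec_le hv) (s - sK)
  have hhead := hrip.l2_mulVec_le hsK.1
  have hE := l2_mulVec_le_colNorm (A := E) hKN hsK.1
  have hsKs := hsK.l2_le
  set β := √(1 + ric A K)
  set εy := l2 e / l2 (A *ᵥ s) with hεy
  set εA := colNorm E K / colNorm A K with hεA
  set q := l2 (s - sK) / l2 s + l1 (s - sK) / (√K * l2 s) with hq
  have hqs : l2 (s - sK) + l1 (s - sK) / √K = q * l2 s := by
    have : 0 < √(K : ℝ) := Real.sqrt_pos.2 (by exact_mod_cast hK)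
    rw [hq]; field_simp
  rw [hqs] at htail
  have hεy0 : 0 ≤ εy := div_nonneg (l2_nonneg _) hy0.le
  have hεA0 : 0 ≤ εA := div_nonneg (colNorm_nonneg _ _) hAc.le
  -- Bounding `‖y‖` through `s_K` and the tail turns `ε_y` into a bound on `‖e‖`; its extra `q`
  -- becomes the factor `1 + ε_y`.
  have hy : l2 (A *ᵥ s) ≤ β * ((1 + q) * l2 s) := by
    have h1 := l2_add_le (A *ᵥ sK) (A *ᵥ (s - sK))
    rw [← mulVec_add, add_sub_cancel] at h1
    have h2 := mul_le_mul_of_nonneg_left hsKs hβ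
    linarith
  have he : l2 e ≤ εy * (β * ((1 + q) * l2 s)) := by
    have : l2 e = εy * l2 (A *ᵥ s) := by rw [hεy]; field_simp
    rw [this]
    exact mul_le_mul_of_nonneg_left hy hεy0
  have hE' : l2 (E *ᵥ sK) ≤ εA * β * l2 s := by
    have h1 : colNorm E K = εA * colNorm A K := by rw [hεA]; field_simp
    have h2 : colNorm E K ≤ εA * β := h1 ▸ mul_le_mul_of_nonneg_left hcol hεA0
    exact hE.trans (mul_le_mul h2 hsKs (l2_nonneg _) (mul_nonneg hεA0 hβ))
  have h1 := l2_add_le (e - E *ᵥ sK) (A *ᵥ (s - sK))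
  have h2 := l2_sub_le e (E *ᵥ sK)
  calc _ ≤ εy * (β * ((1 + q) * l2 s)) + εA * β * l2 s + β * (q * l2 s) := by linarith
    _ = _ := by ring

/-- The base is below 1, so a larger exponent gives a smaller power. -/
theorem mul_pow_le_of_ceil_logb_le {C a q : ℝ} (hC0 : 0 < C) (hC1 : C < 1) (ha : 0 < a)
    (hq : 0 < q) {l : ℕ} (hl : ⌈Real.logb C (q / a)⌉ ≤ (l : ℤ)) : a * C ^ l ≤ q := by
  have h1 : Real.logb C (q / a) ≤ (l : ℝ) := by exact_mod_cast Int.ceil_le.1 hl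
  have h2 := Real.rpow_le_rpow_of_exponent_ge hC0 hC1.le h1
  rw [Real.rpow_logb hC0 hC1.ne (div_pos hq ha), Real.rpow_natCast] at h2
  rw [le_div_iff₀ ha] at h2
  linarith

end GreedyPursuits

open GreedyPursuits

theorem theorem2 (alg : GreedyPursuits.Pursuit) {M N K : ℕ} (hMN : M < N)
    (hK : 1 ≤ K) (hKN : K ≤ N)
    -- sensing matrix, its perturbation, invertible basis matrix
    (Φ Δ : Matrix (Fin M) (Fin N) ℝ) (Ψ : Matrix (Fin N) (Fin N) ℝ) (hΨ : IsUnit Ψ.det)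
    -- signal, measurements, noise
    (s x : Fin N → ℝ) (hx : x = Ψ *ᵥ s)
    (y e : Fin M → ℝ) (hy : y = Φ *ᵥ x) (hy0 : y ≠ 0)
    -- best `K`-term approximation of `s`
    (sK : Fin N → ℝ) (hsK : GreedyPursuits.IsBestApprox K s sK)
    -- `A = Φ Ψ`, its perturbation `E = Δ Ψ`, and the available data `Ã`, `ỹ`
    (A E A' : Matrix (Fin M) (Fin N) ℝ) (hA : A = Φ * Ψ) (hE : E = Δ * Ψ)
    (hA' : A' = (Φ + Δ) * Ψ) (y' : Fin M → ℝ) (hy' : y' = y + e)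
    -- relative perturbations, relative approximation errors, condition number
    (εy εA rK tK κ : ℝ)
    (hεy : εy = GreedyPursuits.l2 e / GreedyPursuits.l2 y)
    (hεA : εA = GreedyPursuits.colNorm E K / GreedyPursuits.colNorm A K)
    (hrK : rK = GreedyPursuits.l2 (s - sK) / GreedyPursuits.l2 s)
    (htK : tK = GreedyPursuits.l1 (s - sK) / (√(K : ℝ) * GreedyPursuits.l2 s))
    (hκ : κ = ‖Ψ‖ * ‖Ψ⁻¹‖)
    -- restricted isometry constants `δ_K` of `A` and `δ̃_{bK}` of `Ã`, and the constants
    (δK δ' C D : ℝ) (hδK : δK = GreedyPursuits.ric A K)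
    (hδ' : δ' = GreedyPursuits.ric A' (alg.b * K))
    (hC : C = alg.C δ') (hD : D = alg.D δ')
    (hRIP : δ' ≤ alg.c)
    -- the iterates of the algorithm, run on `Ã` and `ỹ`
    (si xi : ℕ → Fin N → ℝ) (hsi : alg.IsRun A' y' K si) (hxi : ∀ l, xi l = Ψ *ᵥ si l) :
    (0 < C ∧ C < 1) ∧
    (∀ l : ℕ, GreedyPursuits.l2 (x - xi l) / GreedyPursuits.l2 x ≤
      κ * (alg.a * C ^ l + rK
        + D * √(1 + δK) * (εy + εA + (1 + εy) * (rK + tK)))) ∧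
    (0 < εy + εA + tK → ∀ l : ℕ, ⌈Real.logb C ((εy + εA + tK) / alg.a)⌉ ≤ (l : ℤ) →
      GreedyPursuits.l2 (x - xi l) / GreedyPursuits.l2 x ≤
        κ * (D * √(1 + δK) + 1) * (εy + εA + (1 + εy) * (rK + tK))) := by
  have hAs : y = A *ᵥ s := by rw [hy, hx, hA, mulVec_mulVec]
  have hAs0 : A *ᵥ s ≠ 0 := hAs ▸ hy0
  have hs : s ≠ 0 := by rintro rfl; simp at hAs0
  have hs0 := l2_pos hs
  have hrip : RIP A' (alg.b * K) δ' := hδ' ▸ rip_ric A' _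
  have hb : 3 ≤ alg.b * K := by nlinarith [alg.three_le_b]
  have hδ0 : 0 < δ' := hrip.const_pos hMN (by omega) (hδ' ▸ ric_nonneg _ _)
  have hC0 : 0 < C := hC ▸ alg.C_pos hδ0 hRIP
  have hC1 : C < 1 := hC ▸ alg.C_lt_one hδ0 hRIP
  have hD0 : 0 ≤ D := hD ▸ alg.D_nonneg hδ0 hRIP
  have hε := l2_perturbation_le (E := E) hK hKN hsK hAs0 e
  rw [← hAs, ← hεy, ← hεA, ← hrK, ← htK, ← hδK] at hε
  -- The reduction to an exactly sparse signal.
  have hdata : y' = A' *ᵥ sK + (e - E *ᵥ sK + A *ᵥ (s - sK)) := by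
    have hsum : A' = A + E := by rw [hA', hA, hE, Matrix.add_mul]
    rw [hy', hAs, hsum, add_mulVec, mulVec_sub]; abel
  rw [hdata] at hsi
  have hrK0 : 0 ≤ rK := hrK ▸ div_nonneg (l2_nonneg _) (l2_nonneg _)
  have htK0 : 0 ≤ tK := htK ▸ div_nonneg (l1_nonneg _) (mul_nonneg (Real.sqrt_nonneg _) hs0.le)
  have hεy0 : 0 ≤ εy := hεy ▸ div_nonneg (l2_nonneg _) (l2_nonneg _)
  have hκ0 : 0 ≤ κ := hκ ▸ mul_nonneg (norm_nonneg _) (norm_nonneg _)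
  have hmain : ∀ l : ℕ, l2 (x - xi l) / l2 x ≤ κ * (alg.a * C ^ l + rK
      + D * √(1 + δK) * (εy + εA + (1 + εy) * (rK + tK))) := by
    intro l
    rw [hx, hxi, hκ]
    refine (l2_div_mulVec_le hΨ hs (si l)).trans
      (mul_le_mul_of_nonneg_left ?_ (mul_nonneg (norm_nonneg _) (norm_nonneg _)))
    have h1 := alg.error_le hrip hδ0 hRIP hsK.1 _ hsi l
    rw [← hC, ← hD] at h1
    have h2 := l2_add_le (s - sK) (sK - si l)
    rw [sub_add_sub_cancel] at h2
    have h3 : l2 (s - sK) = rK * l2 s := by rw [hrK]; field_simp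
    have h4 := mul_le_mul_of_nonneg_left hsK.l2_le
      (mul_nonneg alg.a_pos.le (pow_nonneg hC0.le l))
    have h5 := mul_le_mul_of_nonneg_left hε hD0
    rw [div_le_iff₀ hs0]
    linarith
  refine ⟨⟨hC0, hC1⟩, hmain, fun hpos l hl => (hmain l).trans ?_⟩
  have h1 := mul_pow_le_of_ceil_logb_le hC0 hC1 alg.a_pos hpos hl
  rw [mul_assoc κ]
  refine mul_le_mul_of_nonneg_left ?_ hκ0
  -- `a C^l + r_K ≤ ε_y + ε_A + t_K + r_K`, which the final bracket dominates by `ε_y (r_K + t_K)`;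
  -- this is the `+ 1`.
  nlinarith [mul_nonneg hεy0 (add_nonneg hrK0 htK0)]
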